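/- Let $K$ be an algebraically closed field, let $t,u\ge 1$, and put $g=(2t+1)u$, $m=2t(u+1)$. Let $X=E_1\cup\dots\cup E_g$ be a chain of smooth genus-one curves over $K$ with two distinct marked points $p_{(j)},q_{(j)}\in E_j$, where $q_{(j)}$ is glued to $p_{(j+1)}$ for $1\le j<g$, and assume that $X$ is general in the sense that $p_{(j)}-q_{(j)}$ is nontorsion in $\mathrm{Pic}^0(E_j)$ for every $j$. More generally, allow $X$ to be obtained from such a chain by inserting finite chains of rational curves at the nodes (so that a base point at a node of the original chain is represented by a base point on an inserted rational curve). Each component carries its two marked points, and every node joins the second marked point of a component to the first marked point of the next. A limit $g^r_m$ on $X$ (in the sense of Eisenbud and Harris) consists of a line bundle $L_c$ of degree $m$ and an $(r+1)$-dimensional space $V_c\subset H^0(L_c)$ for every component $C_c$ such that at every node the vanishing sequences $a_0<\dots<a_r$ and $b_0<\dots<b_r$ of the two adjacent aspects satisfy $a_i+b_{r-i}\ge m$ for all $i$. For a word $w_1\cdots w_g$ in the letters $1,\dots,r+1$, the limit $g^r_m$ has word type $w$ if for every $j$ the vanishing sequences $a$ and $b$ at the first and second marked point of $E_j$ satisfy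 $a_{w_j-1}+b_{r-(w_j-1)}=m$. Fix a limit $g^{2t}_m$ on $X$, $(L_c,V_c)_c$, of word type $(12\cdots(2t+1))^u$ (so $\rho=0$). An inclusion $g^{t}_{m-(t+1)}+p_1+\dots+p_{t+1}\hookrightarrow g^{2t}_{m}$ into it consists of an effective divisor $Z=p_1+\dots+p_{t+1}$ of degree $t+1$ supported away from the nodes of $X$ and of subspaces $W_c\subset V_c$ of dimension $t+1$ such that $(L_c,W_c)_c$ is a limit $g^t_m$ and every section in $W_c$ vanishes along the restriction of $Z$ to $C_c$. (This is the case $r=1$, $\rho=\mu=0$.) Theorem. The set of these inclusions is in bijection with the set of tuples $$\mathrm S=\{(j_1,\dots,j_{t+1}) : 1\le j_1<\dots<j_{t+1}\le (2t+1)u,\ j_k\not\equiv 2k-1 \pmod{2t+1}\text{ for } k=1,\dots,t+1\},$$ the bijection being given by the components on which the base points lie: if an inclusion corresponds to $(j_1,\dots,j_{t+1})$, then exactly one base point (with multiplicity one) lies on each of $E_{j_1},\dots,E_{j_{t+1}}$, and no other component of $X$, in particular no inserted rational curve, contains a base point. -/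

import Mathlib

universe u v

/-- A closed point of the smooth projective curve with function field `F` over `K`: a normalized
discrete valuation of `F` which is trivial on the constants `K`. Here `ord f` is the order of
vanishing of the rational function `f` at the point, with `ord 0 = ⊤`. -/
@[ext]
structure Place (K : Type u) (F : Type v) [Field K] [Field F] [Algebra K F] where
  ord : AddValuation F (WithTop ℤ)
  ord_const : ∀ a : K, a ≠ 0 → ord (algebraMap K F a) = 0
  exists_uniformizer : ∃ π : F, ord π = 1

/-- `F` is the function field of an algebraic curve over `K`: it is a finite extension of a purely
transcendental extension `K(x)`. (For `K` algebraically closed such fields are exactly the function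
fields of smooth projective irreducible curves, and the curve is determined by its field.) -/
def IsCurveFunctionField (K : Type u) (F : Type v) [Field K] [Field F] [Algebra K F] : Prop :=
  ∃ x : F, Transcendental K x ∧ FiniteDimensional (IntermediateField.adjoin K {x}) F

section Curve

variable (K : Type u) (F : Type v) [Field K] [Field F] [Algebra K F]

/-- Divisors on the smooth projective curve with function field `F`. -/
abbrev CurveDivisor := Place K F →₀ ℤ

variable {K F}

/-- The degree of a divisor (all points have residue field `K` when `K` is algebraically closed). -/
def CurveDivisor.deg (D : CurveDivisor K F) : ℤ := D.sum fun _ n => n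

/-- `D` is the divisor of a nonzero rational function. -/
def CurveDivisor.IsPrincipal (D : CurveDivisor K F) : Prop :=
  ∃ f : F, f ≠ 0 ∧ ∀ P : Place K F, P.ord f = ((D P : ℤ) : WithTop ℤ)

/-- The space of global sections `H⁰(𝒪(D)) = {f : div f + D ≥ 0} ∪ {0}`. -/
def CurveDivisor.sections (D : CurveDivisor K F) : Submodule K F where
  carrier := {f | ∀ P : Place K F, ((-(D P) : ℤ) : WithTop ℤ) ≤ P.ord f}
  zero_mem' := by
    intro P
    rw [AddValuation.map_zero]
    exact le_top
  add_mem' := by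
    intro f g hf hg P
    exact AddValuation.map_le_add _ (hf P) (hg P)
  smul_mem' := by
    intro a f hf P
    by_cases ha : a = 0
    · rw [ha, zero_smul, AddValuation.map_zero]
      exact le_top
    · rw [Algebra.smul_def, AddValuation.map_mul, P.ord_const a ha, zero_add]
      exact hf P

variable (K F)

/-- The curve with function field `F` has genus `γ`, where the genus is the maximum of
`deg D + 1 - h⁰(D)` over all divisors `D`. -/
def HasGenus (γ : ℤ) : Prop :=
  IsGreatest
    (Set.range fun D : CurveDivisor K F => D.deg + 1 - (Module.finrank K D.sections : ℤ)) γ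

variable {K F}

/-- Some nonzero member of `V`, viewed as a section of the line bundle `𝒪(D)`, vanishes to order
exactly `n` at `P`. -/
def HasVanishingOrder (D : CurveDivisor K F) (V : Submodule K F) (P : Place K F) (n : ℕ) : Prop :=
  ∃ f ∈ V, f ≠ 0 ∧ P.ord f = (((n : ℤ) - D P : ℤ) : WithTop ℤ)

/-- The `i`-th term (counted from `0`) of the vanishing sequence `a₀ < a₁ < ⋯ < a_r` at `P` of a
linear series `V ⊆ H⁰(𝒪(D))` of dimension `r` (so that `V` has dimension `r + 1`). -/
noncomputable def vanishingSeq (D : CurveDivisor K F) (V : Submodule K F) (P : Place K F)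
    (i : ℕ) : ℕ :=
  Nat.nth (HasVanishingOrder D V P) i

end Curve

/-- A general chain of `g` elliptic curves, in which rational curves may have been inserted at the
nodes. The components are indexed by `Fin N`; component `c` is the smooth projective curve with
function field `F c` and carries two marked points `p c`, `q c`, and `q c` is glued to `p (c + 1)`
to form a node. (The points `p` of the first and `q` of the last component are no nodes.)
Component `elliptic j` is the `j`-th elliptic curve. For `N = g` there are no inserted components
and this is a chain of `g` elliptic curves. -/
structure EllipticChain (K : Type u) [Field K] (g N : ℕ) where
  F : Fin N → Type v
  [field : ∀ c, Field (F c)]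
  [algebra : ∀ c, Algebra K (F c)]
  isCurve : ∀ c, IsCurveFunctionField K (F c)
  p : ∀ c, Place K (F c)
  q : ∀ c, Place K (F c)
  p_ne_q : ∀ c, p c ≠ q c
  elliptic : Fin g ↪o Fin N
  genus_elliptic : ∀ j, HasGenus K (F (elliptic j)) 1
  genus_inserted : ∀ c, c ∉ Set.range elliptic → HasGenus K (F c) 0
  /-- The inserted curves lie between elliptic ones: they replace nodes. -/
  between : ∀ c, ∃ i j, elliptic i ≤ c ∧ c ≤ elliptic j
  /-- Generality: on each elliptic component the difference of the marked points is nontorsion. -/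
  nontorsion : ∀ (j : Fin g) (n : ℤ), n ≠ 0 →
    ¬ CurveDivisor.IsPrincipal
      (Finsupp.single (p (elliptic j)) n - Finsupp.single (q (elliptic j)) n)

attribute [instance] EllipticChain.field EllipticChain.algebra

namespace EllipticChain

variable {K : Type u} [Field K] {g N : ℕ} (X : EllipticChain.{u, v} K g N)

/-- A limit linear series of degree `m` and dimension `r` on the chain, in the sense of Eisenbud and
Harris: on every component `c` an `(r + 1)`-dimensional space `V c` of sections of the degree-`m`
line bundle `𝒪(D c)`, such that at every node the vanishing sequences `a`, `b` of the two adjacent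
aspects satisfy `a_i + b_{r-i} ≥ m`. -/
structure IsLimitLinearSeries (r : ℕ) (m : ℕ) (D : ∀ c, CurveDivisor K (X.F c))
    (V : ∀ c, Submodule K (X.F c)) : Prop where
  degree : ∀ c, (D c).deg = m
  le_sections : ∀ c, V c ≤ (D c).sections
  finrank_eq : ∀ c, Module.finrank K (V c) = r + 1
  compatible : ∀ c c' : Fin N, (c' : ℕ) = c + 1 → ∀ i ≤ r,
    m ≤ vanishingSeq (D c) (V c) (X.q c) i + vanishingSeq (D c') (V c') (X.p c') (r - i)

/-- The limit linear series has word type `w`, a string of length `g` in `r + 1` letters (the letter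
`k + 1` being written as `k : Fin (r + 1)`): on the `j`-th elliptic component the aligned vanishing
orders, those of total `m` in the two marked points, are the ones with index `w j`. (When the
Brill-Noether number is zero this says that, in passing from `p` on the `j`-th elliptic component to
`p` on the next component, all vanishing orders increase by one except for the one with index `w j`,
which is unchanged.) -/
def HasWordType (r : ℕ) (m : ℕ) (D : ∀ c, CurveDivisor K (X.F c))
    (V : ∀ c, Submodule K (X.F c)) (w : Fin g → Fin (r + 1)) : Prop :=
  ∀ j : Fin g,
    vanishingSeq (D (X.elliptic j)) (V (X.elliptic j)) (X.p (X.elliptic j)) (w j) +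
      vanishingSeq (D (X.elliptic j)) (V (X.elliptic j)) (X.q (X.elliptic j)) (r - w j) = m

/-- An inclusion `g^{r₂}_{m-d} + p₁ + ⋯ + p_d ↪ g^{r₁}_m` into a fixed limit linear series `(D, V)`
of degree `m` on the chain: an effective divisor `p₁ + ⋯ + p_d` supported away from the nodes, and a
limit linear series of dimension `r₂` whose aspects `W c` are contained in those of the given one
and consist of sections which vanish along that divisor. -/
@[ext]
structure Inclusion (r₂ d m : ℕ) (D : ∀ c, CurveDivisor K (X.F c))
    (V : ∀ c, Submodule K (X.F c)) where
  base : ∀ c, CurveDivisor K (X.F c)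
  W : ∀ c, Submodule K (X.F c)
  base_effective : ∀ c P, 0 ≤ base c P
  base_degree : ∑ c, (base c).deg = d
  /-- The point `p c` is a node unless `c` is the first component. -/
  base_p : ∀ c : Fin N, 0 < (c : ℕ) → base c (X.p c) = 0
  /-- The point `q c` is a node unless `c` is the last component. -/
  base_q : ∀ c : Fin N, (c : ℕ) + 1 < N → base c (X.q c) = 0
  isLimitLinearSeries : X.IsLimitLinearSeries r₂ m D W
  le_ambient : ∀ c, W c ≤ V c
  vanish_on_base : ∀ c, W c ≤ (D c - base c).sections

end EllipticChain

/-- The word `(12⋯n)^u` of length `n * u` for `n = 2t + 1`, with the letter `k + 1` written as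
`k : Fin n`. -/
def periodicWord (t u : ℕ) (j : Fin ((2 * t + 1) * u)) : Fin (2 * t + 1) :=
  Fin.ofNat (2 * t + 1) j

/-- The tuples `1 ≤ j₁ < ⋯ < j_{t+1} ≤ (2t+1)u` with `j_k ≢ 2k - 1 (mod 2t + 1)` for
`k = 1, …, t + 1`; the entry `j_k` is `j (k - 1)`. -/
def admissibleTuples (t u : ℕ) : Set (Fin (t + 1) → ℕ) :=
  {j | StrictMono j ∧ (∀ k, 1 ≤ j k ∧ j k ≤ (2 * t + 1) * u) ∧
    ∀ k : Fin (t + 1), ¬ (j k ≡ 2 * (k : ℕ) + 1 [MOD 2 * t + 1])}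

/-! Generality and ρ = 0 pin down the ambient series. Its vanishing sequences are the ones read off
the word (`vanishingSeq_eq_orderAt`), and each V_c has a basis f_i adapted to both marked points
(`AdaptedFrame`). The vanishing sequences of W_c are then subsequences, given by indices σ_k at p
and τ_k at q with σ_k ≤ τ_k.

The core is a count of ∑ σ_k along the chain. By a degree comparison, d base points on an elliptic
component raise the sum by at least td, and by more if d ≥ 2, since nontorsion lets at most one
index attain the degree bound (`sum_index_elliptic`). On an inserted curve the rise exceeds td as
soon as d ≥ 1 (`sum_index_inserted`), and base points at the two free ends of the chain cost t + 1
each. The sum starts at ∑ k or above and ends at ∑ (k + t) or below, which leaves room for t(t + 1).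
Hence each of the t + 1 base points costs exactly t: there is at most one per elliptic component,
none elsewhere, and the indices agree across nodes.

A base point thus raises all indices but one by 1. Index k travels from k to k + t in t + 1
opportunities, so it stalls exactly once, and strict monotonicity makes the indices stall in the
order 0, 1, …, t (`eq_shiftIndex`). With e base points before it, the next one stalls index e at the
value 2e. This is possible only if the ambient order of index 2e increases on that component, that
is, if its letter is not 2e + 1; this is the congruence condition.

Conversely, under that condition f_{2e} has a single further zero z, which must be the base point,
and each other basis section of W_c is the unique member vanishing at z of a pencil ⟨f_i, f_{i+1}⟩
(`existsUnique_isLocalInclusion_one`). On the remaining components W_c is spanned by members of the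
adapted basis. So the distribution of base points determines the inclusion, and every admissible
distribution occurs. -/

namespace Place

/-! ### Places: orders of functions and residue fields. -/

variable {K : Type u} {F : Type v} [Field K] [Field F] [Algebra K F]

theorem ord_algebraMap_nonneg (P : Place K F) (a : K) : 0 ≤ P.ord (algebraMap K F a) := by
  by_cases ha : a = 0
  · simp [ha]
  · rw [P.ord_const a ha]

theorem ord_smul (P : Place K F) {a : K} (ha : a ≠ 0) (f : F) : P.ord (a • f) = P.ord f := by
  rw [Algebra.smul_def, AddValuation.map_mul, P.ord_const a ha, zero_add]

theorem exists_ord_eq (P : Place K F) {f : F} (hf : f ≠ 0) : ∃ n : ℤ, P.ord f = (n : WithTop ℤ) := by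
  have h := (AddValuation.ne_top_iff P.ord).2 hf
  obtain ⟨n, hn⟩ := WithTop.ne_top_iff_exists.1 h
  exact ⟨n, hn.symm⟩

/-- The functions vanishing to order at least `n` at `P`. -/
def ordGE (P : Place K F) (n : ℤ) : Submodule K F where
  carrier := {f | (n : WithTop ℤ) ≤ P.ord f}
  zero_mem' := by
    rw [Set.mem_ofPred_eq, AddValuation.map_zero]
    exact le_top
  add_mem' := by
    intro f g hf hg
    exact AddValuation.map_le_add P.ord (g := (n : WithTop ℤ)) hf hg
  smul_mem' := by
    intro a f hf
    by_cases ha : a = 0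
    · rw [ha, zero_smul, Set.mem_ofPred_eq, AddValuation.map_zero]
      exact le_top
    · rw [Set.mem_ofPred_eq, P.ord_smul ha]
      exact hf

theorem mem_ordGE {P : Place K F} {n : ℤ} {f : F} : f ∈ P.ordGE n ↔ (n : WithTop ℤ) ≤ P.ord f := by
  exact Iff.rfl

theorem ordGE_anti (P : Place K F) {n n' : ℤ} (h : n ≤ n') : P.ordGE n' ≤ P.ordGE n := by
  intro f hf
  exact le_trans (WithTop.coe_le_coe.2 h) (mem_ordGE.1 hf)

theorem mem_ordGE_of_ord_eq {P : Place K F} {n n' : ℤ} {f : F} (h : P.ord f = (n' : WithTop ℤ)) :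
    f ∈ P.ordGE n ↔ n ≤ n' := by
  rw [mem_ordGE, h, WithTop.coe_le_coe]

/-- The polynomial splits into linear factors and the order of a product is the sum of the orders,
so positivity must come from some factor `f - a`. Nonzero constants have order 0, which excludes
degree 0. -/
theorem exists_root_of_ord_aeval_pos [IsAlgClosed K] (P : Place K F) {f : F} (hf : 0 ≤ P.ord f)
    (n : ℕ) : ∀ g : Polynomial K, g.natDegree = n → g ≠ 0 → 0 < P.ord (Polynomial.aeval f g) →
      ∃ a : K, 0 < P.ord (f - algebraMap K F a) := by
  induction n with
  | zero =>
    intro g hg hg0 hpos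
    rw [Polynomial.eq_C_of_natDegree_eq_zero hg, Polynomial.aeval_C, P.ord_const] at hpos
    · exact absurd hpos (lt_irrefl _)
    · intro h
      apply hg0
      rw [Polynomial.eq_C_of_natDegree_eq_zero hg, h, Polynomial.C_0]
  | succ n ih =>
    intro g hg hg0 hpos
    obtain ⟨a, ha⟩ := IsAlgClosed.exists_root g (by
      intro h
      have := Polynomial.natDegree_eq_of_degree_eq_some h
      rw [hg] at this
      exact Nat.succ_ne_zero n this)
    obtain ⟨g', rfl⟩ := Polynomial.dvd_iff_isRoot.2 ha
    by_cases hfa : 0 < P.ord (f - algebraMap K F a)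
    · exact ⟨a, hfa⟩
    · have hg'0 : g' ≠ 0 := right_ne_zero_of_mul hg0
      have hdeg : g'.natDegree = n := by
        rw [Polynomial.natDegree_mul (Polynomial.X_sub_C_ne_zero a) hg'0,
          Polynomial.natDegree_X_sub_C] at hg
        omega
      refine ih g' hdeg hg'0 ?_
      have h0 : P.ord (f - algebraMap K F a) = 0 :=
        le_antisymm (not_lt.1 hfa) (AddValuation.map_le_sub _ hf (P.ord_algebraMap_nonneg a))
      rw [map_mul, AddValuation.map_mul] at hpos
      simpa [h0] using hpos

/-- The transcendence degree is at most one, so a single transcendental element is already a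
transcendence basis. -/
theorem isAlgebraic_adjoin_of_transcendental (hF : IsCurveFunctionField K F) {f : F}
    (hf : Transcendental K f) : Algebra.IsAlgebraic (Algebra.adjoin K {f}) F := by
  obtain ⟨x, hx, hfin⟩ := hF
  have hle : Algebra.trdeg K F ≤ 1 := by
    have : Algebra.IsAlgebraic (IntermediateField.adjoin K {x}) F := Algebra.IsAlgebraic.of_finite _ _
    have h2 : Algebra.IsAlgebraic (Algebra.adjoin K {x}) F :=
      IntermediateField.isAlgebraic_adjoin_iff_top.1 this
    simpa using Algebra.IsAlgebraic.trdeg_le_cardinalMk K ({x} : Set F)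
  have hai : AlgebraicIndependent K (fun _ : PUnit.{v+1} => f) :=
    algebraicIndependent_unique_type_iff.2 hf
  have hb := hai.isTranscendenceBasis_of_trdeg_le
    (hle.trans_lt Cardinal.one_lt_aleph0) (by simpa using hle)
  have := hb.isAlgebraic
  rwa [Set.range_const] at this

/-- It suffices to find a nonzero polynomial `g` with `g(f)` of positive order. For algebraic `f` an
annihilating polynomial will do. Otherwise a uniformizer is algebraic over `K[f]`, and the constant
coefficient of an algebraic relation for it is a polynomial in `f` lying in the maximal ideal. -/
theorem exists_sub_algebraMap_mem_maximal [IsAlgClosed K] (hF : IsCurveFunctionField K F)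
    (P : Place K F) {f : F} (hf : 0 ≤ P.ord f) : ∃ a : K, 0 < P.ord (f - algebraMap K F a) := by
  by_cases halg : IsAlgebraic K f
  · obtain ⟨g, hg0, hg⟩ := halg
    refine P.exists_root_of_ord_aeval_pos hf _ g rfl hg0 ?_
    rw [hg, AddValuation.map_zero]
    exact WithTop.coe_lt_top 0
  · obtain ⟨π, hπ⟩ := P.exists_uniformizer
    have hπ0 : π ≠ 0 := by
      rintro rfl
      rw [AddValuation.map_zero] at hπ
      exact absurd hπ (WithTop.coe_ne_top (a := 1)).symm
    have := (isAlgebraic_adjoin_of_transcendental hF halg).isAlgebraic π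
    -- As `π ≠ 0`, the relation can be chosen with nonzero constant coefficient, which later gives
    -- `g ≠ 0`.
    obtain ⟨q, hq0, hq⟩ := this.exists_nonzero_coeff_and_aeval_eq_zero
      (mem_nonZeroDivisors_of_ne_zero hπ0)
    have hnn : ∀ s : Algebra.adjoin K {f}, 0 ≤ P.ord (s : F) := by
      rintro ⟨s, hs⟩
      rw [Algebra.adjoin_singleton_eq_range_aeval] at hs
      obtain ⟨g, rfl⟩ := hs
      change 0 ≤ P.ord (Polynomial.aeval f g)
      rw [Polynomial.aeval_eq_sum_range]
      refine AddValuation.map_le_sum _ fun i _ => ?_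
      rw [Algebra.smul_def, AddValuation.map_mul, AddValuation.map_pow]
      exact add_nonneg (P.ord_algebraMap_nonneg _) (nsmul_nonneg hf _)
    obtain ⟨g, hg⟩ : ∃ g : Polynomial K, Polynomial.aeval f g = (q.coeff 0 : F) := by
      have h : ∀ s ∈ Algebra.adjoin K {f}, ∃ g : Polynomial K, Polynomial.aeval f g = s := by
        intro s hs
        rw [Algebra.adjoin_singleton_eq_range_aeval] at hs
        exact hs
      exact h _ (q.coeff 0).2
    refine P.exists_root_of_ord_aeval_pos hf _ g rfl ?_ ?_
    · rintro rfl
      apply hq0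
      rw [map_zero] at hg
      exact Subtype.ext hg.symm
    · rw [hg]
      have hdecomp : (q.coeff 0 : F) = -(π * Polynomial.aeval π q.divX) := by
        have h := congrArg (Polynomial.aeval π) (Polynomial.X_mul_divX_add q)
        rw [hq, map_add, map_mul, Polynomial.aeval_X, Polynomial.aeval_C] at h
        exact eq_neg_of_add_eq_zero_right h
      rw [hdecomp, AddValuation.map_neg, AddValuation.map_mul, hπ]
      have : 0 ≤ P.ord (Polynomial.aeval π q.divX) := by
        rw [Polynomial.aeval_eq_sum_range]
        refine AddValuation.map_le_sum _ fun i _ => ?_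
        rw [Algebra.smul_def, AddValuation.map_mul, AddValuation.map_pow, hπ]
        exact add_nonneg (hnn _) (nsmul_nonneg zero_le_one _)
      exact lt_of_lt_of_le zero_lt_one (le_add_of_nonneg_right this)

/-- The residue field of every place is the field of constants. -/
def HasTrivialResidues (K : Type u) (F : Type v) [Field K] [Field F] [Algebra K F] : Prop :=
  ∀ (P : Place K F) (f : F), 0 ≤ P.ord f → ∃ a : K, 0 < P.ord (f - algebraMap K F a)

theorem hasTrivialResidues [IsAlgClosed K] (hF : IsCurveFunctionField K F) :
    HasTrivialResidues K F := fun P _ hf => P.exists_sub_algebraMap_mem_maximal hF hf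

/-- The constant is the residue of `f / g`, a function of nonnegative order. -/
theorem HasTrivialResidues.exists_sub_smul_mem (hF : HasTrivialResidues K F) {P : Place K F} {n : ℤ}
    {f g : F} (hf : f ∈ P.ordGE n) (hg : P.ord g = (n : WithTop ℤ)) :
    ∃ a : K, f - a • g ∈ P.ordGE (n + 1) := by
  have hg0 : g ≠ 0 := by
    rintro rfl
    rw [AddValuation.map_zero] at hg
    exact absurd hg.symm WithTop.coe_ne_top
  by_cases hf0 : f = 0
  · exact ⟨0, by simp [hf0]⟩
  obtain ⟨k, hk⟩ := P.exists_ord_eq hf0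
  have hnk : n ≤ k := (mem_ordGE_of_ord_eq hk).1 hf
  obtain ⟨l, hl⟩ := P.exists_ord_eq (div_ne_zero hf0 hg0)
  have hkl : k = l + n := by
    have h : P.ord (f / g * g) = P.ord f := by rw [div_mul_cancel₀ _ hg0]
    rw [AddValuation.map_mul, hl, hg, hk, ← WithTop.coe_add, WithTop.coe_eq_coe] at h
    exact h.symm
  obtain ⟨a, ha⟩ := hF P (f / g) (by rw [hl]; exact WithTop.coe_le_coe.2 (by omega))
  refine ⟨a, ?_⟩
  have hfac : f - a • g = (f / g - algebraMap K F a) * g := by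
    rw [sub_mul, div_mul_cancel₀ _ hg0, Algebra.smul_def]
  by_cases h0 : f / g - algebraMap K F a = 0
  · rw [hfac, h0, zero_mul]
    exact zero_mem _
  · obtain ⟨i, hi⟩ := P.exists_ord_eq h0
    rw [hi] at ha
    have hi0 : 0 < i := WithTop.coe_lt_coe.1 ha
    rw [mem_ordGE, hfac, AddValuation.map_mul, hi, hg, ← WithTop.coe_add]
    exact WithTop.coe_le_coe.2 (by omega)

/-- A linear combination of functions of pairwise distinct orders at `P` vanishes at most to the
order of any function occurring in it. -/
theorem ord_sum_smul_le (P : Place K F) {ι : Type*} (S : Finset ι) (f : ι → F) (o : ι → ℤ)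
    (ho : Set.InjOn o S) (hord : ∀ i ∈ S, P.ord (f i) = (o i : WithTop ℤ)) (c : ι → K) {l : ι}
    (hl : l ∈ S) (hc : c l ≠ 0) : P.ord (∑ i ∈ S, c i • f i) ≤ (o l : WithTop ℤ) := by
  classical
  -- Among the terms with nonzero coefficient, the one of least order is unique and determines the
  -- order of the sum.
  obtain ⟨i₀, hi₀, hmin⟩ := Finset.exists_min_image (S.filter fun i => c i ≠ 0) o
    ⟨l, by simp [hl, hc]⟩
  rw [Finset.mem_filter] at hi₀
  have h0 : P.ord (c i₀ • f i₀) = (o i₀ : WithTop ℤ) := by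
    rw [P.ord_smul hi₀.2, hord _ hi₀.1]
  have hlt : P.ord (c i₀ • f i₀) < P.ord (∑ i ∈ S.erase i₀, c i • f i) := by
    rw [h0]
    refine AddValuation.map_lt_sum _ WithTop.coe_ne_top fun i hi => ?_
    rw [Finset.mem_erase] at hi
    by_cases hci : c i = 0
    · rw [hci, zero_smul, AddValuation.map_zero]
      exact WithTop.coe_lt_top _
    · rw [P.ord_smul hci, hord _ hi.2]
      refine WithTop.coe_lt_coe.2 (lt_of_le_of_ne (hmin i (by simp [hi.2, hci])) fun h => ?_)
      exact hi.1 (ho hi.2 hi₀.1 h.symm)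
  rw [← Finset.add_sum_erase S _ hi₀.1, AddValuation.map_add_eq_of_lt_left _ hlt, h0]
  exact WithTop.coe_le_coe.2 (hmin l (by simp [hl, hc]))

theorem linearIndependent_of_ord_injective (P : Place K F) {ι : Type*} (f : ι → F) (o : ι → ℤ)
    (ho : Function.Injective o) (hord : ∀ i, P.ord (f i) = (o i : WithTop ℤ)) :
    LinearIndependent K f := by
  rw [linearIndependent_iff']
  intro S c hsum i hi
  by_contra hci
  have := P.ord_sum_smul_le S f o ho.injOn (fun i _ => hord i) c hi hci
  rw [hsum, AddValuation.map_zero, top_le_iff] at this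
  exact WithTop.coe_ne_top this

end Place

/-! ### Divisors: dimension bounds and degrees of sections. -/

open Place CurveDivisor

namespace CurveDivisor

variable {K : Type u} {F : Type v} [Field K] [Field F] [Algebra K F]

theorem deg_add (D E : CurveDivisor K F) : (D + E).deg = D.deg + E.deg :=
  Finsupp.sum_add_index' (fun _ => rfl) fun _ _ _ => rfl

theorem deg_single (P : Place K F) (n : ℤ) : deg (Finsupp.single P n) = n :=
  Finsupp.sum_single_index rfl

theorem deg_zero : deg (0 : CurveDivisor K F) = 0 :=
  Finsupp.sum_zero_index

theorem deg_neg (D : CurveDivisor K F) : (-D).deg = -D.deg := by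
  have h := deg_add D (-D)
  rw [add_neg_cancel, deg_zero] at h
  omega

theorem deg_sub (D E : CurveDivisor K F) : (D - E).deg = D.deg - E.deg := by
  rw [sub_eq_add_neg, deg_add, deg_neg, sub_eq_add_neg]

theorem deg_nonneg {D : CurveDivisor K F} (h : ∀ P, 0 ≤ D P) : 0 ≤ D.deg :=
  Finset.sum_nonneg fun P _ => h P

theorem eq_zero_of_deg_eq_zero {D : CurveDivisor K F} (h : ∀ P, 0 ≤ D P) (h0 : D.deg = 0) :
    D = 0 := by
  ext P
  by_contra hP
  have := (Finset.sum_eq_zero_iff_of_nonneg fun P _ => h P).1 h0 P (Finsupp.mem_support_iff.2 hP)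
  exact hP this

theorem exists_single_le {D : CurveDivisor K F} (h : ∀ P, 0 ≤ D P) (h0 : 0 < D.deg) :
    ∃ P, ∀ Q, 0 ≤ (D - Finsupp.single P 1 : CurveDivisor K F) Q := by
  classical
  obtain ⟨P, hP⟩ : ∃ P, D P ≠ 0 := by
    by_contra hcon
    push Not at hcon
    have : D = 0 := Finsupp.ext hcon
    rw [this, deg_zero] at h0
    exact lt_irrefl _ h0
  refine ⟨P, fun Q => ?_⟩
  rw [Finsupp.sub_apply, Finsupp.single_apply]
  have := h P
  have := h Q
  split_ifs with hPQ
  · subst hPQ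
    omega
  · omega

theorem eq_single_of_deg_eq_one {D : CurveDivisor K F} (h : ∀ P, 0 ≤ D P) (h1 : D.deg = 1) :
    ∃ P, D = Finsupp.single P 1 := by
  obtain ⟨P, hP⟩ := exists_single_le h (by omega)
  refine ⟨P, sub_eq_zero.1 (eq_zero_of_deg_eq_zero hP ?_)⟩
  rw [deg_sub, deg_single, h1, sub_self]

theorem mem_sections {D : CurveDivisor K F} {f : F} :
    f ∈ D.sections ↔ ∀ P : Place K F, f ∈ P.ordGE (-(D P)) := by
  exact Iff.rfl

theorem sections_mono {D E : CurveDivisor K F} (h : ∀ P, D P ≤ E P) : D.sections ≤ E.sections :=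
  fun _ hf => mem_sections.2 fun P => P.ordGE_anti (neg_le_neg (h P)) (mem_sections.1 hf P)

theorem mem_sections_sub_single {D : CurveDivisor K F} {f : F} (hf : f ∈ D.sections)
    {P : Place K F} (h : f ∈ P.ordGE (-(D P) + 1)) :
    f ∈ (D - Finsupp.single P 1).sections := by
  classical
  refine mem_sections.2 fun Q => ?_
  rw [Finsupp.sub_apply, Finsupp.single_apply]
  split_ifs with hPQ
  · subst hPQ
    rwa [show -(D P - 1) = -(D P) + 1 by ring]
  · rw [sub_zero]
    exact mem_sections.1 hf Q

theorem mul_mem_sections {D E : CurveDivisor K F} {f g : F} (hf : f ∈ D.sections)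
    (hg : g ∈ E.sections) : f * g ∈ (D + E).sections := by
  refine mem_sections.2 fun P => ?_
  rw [mem_ordGE, AddValuation.map_mul, Finsupp.add_apply, neg_add, WithTop.coe_add]
  exact add_le_add (mem_ordGE.1 (mem_sections.1 hf P)) (mem_ordGE.1 (mem_sections.1 hg P))

/-- Only one new pole order at `P` is allowed, and a section attaining it can be reduced to a
section of `𝒪(D)` by subtracting a multiple of one fixed such `g`. -/
theorem sections_add_single (hF : HasTrivialResidues K F) (D : CurveDivisor K F) (P : Place K F) :
    ∃ g, (D + Finsupp.single P 1).sections ≤ D.sections ⊔ Submodule.span K {g} := by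
  classical
  have key : ∀ f ∈ (D + Finsupp.single P 1).sections, f ∈ P.ordGE (-(D P)) → f ∈ D.sections := by
    intro f hf hfP
    have := mem_sections_sub_single hf (P := P) (by simpa using hfP)
    simpa using this
  by_cases h : (D + Finsupp.single P 1).sections ≤ D.sections
  · exact ⟨0, h.trans le_sup_left⟩
  · obtain ⟨g, hg, hgD⟩ := SetLike.not_le_iff_exists.1 h
    have hg0 : g ≠ 0 := by
      rintro rfl
      exact hgD (zero_mem _)
    have hgP : ∀ f ∈ (D + Finsupp.single P 1).sections, f ∈ P.ordGE (-(D P) - 1) := by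
      intro f hf
      have := mem_sections.1 hf P
      rwa [Finsupp.add_apply, Finsupp.single_eq_same, neg_add, ← sub_eq_add_neg] at this
    obtain ⟨k, hk⟩ := P.exists_ord_eq hg0
    have hk' : k = -(D P) - 1 := by
      have h1 := (mem_ordGE_of_ord_eq hk).1 (hgP g hg)
      have h2 : ¬ (-(D P) ≤ k) := fun h2 => hgD (key g hg ((mem_ordGE_of_ord_eq hk).2 h2))
      omega
    subst hk'
    refine ⟨g, fun f hf => ?_⟩
    obtain ⟨a, ha⟩ := hF.exists_sub_smul_mem (hgP f hf) hk
    rw [sub_add_cancel] at ha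
    have := key _ (sub_mem hf (Submodule.smul_mem _ a hg)) ha
    rw [← sub_add_cancel f (a • g)]
    exact Submodule.add_mem_sup this (Submodule.smul_mem _ a (Submodule.mem_span_singleton_self g))

theorem finrank_sections_add_single (hF : HasTrivialResidues K F) (D : CurveDivisor K F)
    (P : Place K F) (hD : FiniteDimensional K D.sections) :
    FiniteDimensional K (D + Finsupp.single P 1).sections ∧
      Module.finrank K (D + Finsupp.single P 1).sections ≤ Module.finrank K D.sections + 1 := by
  obtain ⟨g, hg⟩ := sections_add_single hF D P
  have h2 : Module.finrank K (Submodule.span K {g}) ≤ 1 := by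
    simpa using finrank_span_le_card (R := K) ({g} : Set F)
  refine ⟨Submodule.finiteDimensional_of_le hg, (Submodule.finrank_mono hg).trans ?_⟩
  exact (Submodule.finrank_add_le_finrank_add_finrank _ _).trans (by omega)

theorem finrank_sections_add_effective (hF : HasTrivialResidues K F) (D : CurveDivisor K F)
    (hD : FiniteDimensional K D.sections) (n : ℕ) :
    ∀ E : CurveDivisor K F, (∀ P, 0 ≤ E P) → E.deg = n →
      FiniteDimensional K (D + E).sections ∧
        Module.finrank K (D + E).sections ≤ Module.finrank K D.sections + n := by
  induction n with
  | zero =>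
    intro E hE h0
    rw [eq_zero_of_deg_eq_zero hE h0, add_zero]
    exact ⟨hD, le_rfl⟩
  | succ n ih =>
    intro E hE hdeg
    push_cast at hdeg
    obtain ⟨P, hP⟩ := exists_single_le hE (by omega)
    obtain ⟨h1, h2⟩ := ih _ hP (by rw [deg_sub, deg_single]; omega)
    obtain ⟨h3, h4⟩ := finrank_sections_add_single hF _ P h1
    rw [add_assoc, sub_add_cancel] at h3 h4
    exact ⟨h3, h4.trans (by omega)⟩

theorem finrank_sections_of_le (hF : HasTrivialResidues K F) {D E : CurveDivisor K F}
    (hD : FiniteDimensional K D.sections) (h : ∀ P, D P ≤ E P) :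
    FiniteDimensional K E.sections ∧
      (Module.finrank K E.sections : ℤ) ≤ Module.finrank K D.sections + (E.deg - D.deg) := by
  have hnn : ∀ P, 0 ≤ (E - D) P := fun P => by
    rw [Finsupp.sub_apply]
    exact sub_nonneg.2 (h P)
  obtain ⟨n, hn⟩ := Int.eq_ofNat_of_zero_le (deg_nonneg hnn)
  obtain ⟨h1, h2⟩ := finrank_sections_add_effective hF D hD n _ hnn hn
  rw [add_sub_cancel] at h1 h2
  refine ⟨h1, ?_⟩
  rw [deg_sub] at hn
  omega

/-- The genus bound yields one divisor with a finite-dimensional space of sections; the passage to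
any other divisor changes the dimension by finitely much. -/
theorem finiteDimensional_sections (hF : HasTrivialResidues K F) {γ : ℤ} (hγ : HasGenus K F γ)
    (P : Place K F) (D : CurveDivisor K F) : FiniteDimensional K D.sections := by
  have hex : ∃ E : CurveDivisor K F, FiniteDimensional K E.sections := by
    by_contra hcon
    push Not at hcon
    have h1 := hγ.2 ⟨Finsupp.single P (max γ 0), rfl⟩
    -- An infinite-dimensional space has `finrank` 0, so large degrees would violate the genus
    -- bound.
    have h2 : Module.finrank K (sections (Finsupp.single P (max γ 0) : CurveDivisor K F)) = 0 :=
      Module.finrank_of_not_finite (hcon _)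
    simp only [h2, deg_single] at h1
    have := le_max_left γ 0
    push_cast at h1
    omega
  obtain ⟨E, hE⟩ := hex
  have h1 : FiniteDimensional K (D ⊔ E).sections :=
    (finrank_sections_of_le hF hE fun P => le_sup_right (a := D P)).1
  exact Submodule.finiteDimensional_of_le
    (sections_mono (D := D) (E := D ⊔ E) fun P => le_sup_left (b := E P))

/-- Multiplication by `f` embeds H⁰(E) into H⁰(D + E). For large `E` the genus bounds the first
dimension below by deg E + 1 - γ, and a divisor attaining the genus bounds the second above by deg(D
+ E) + 1 - γ. -/
theorem deg_nonneg_of_mem_sections (hF : HasTrivialResidues K F) {γ : ℤ} (hγ : HasGenus K F γ)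
    (P : Place K F) {D : CurveDivisor K F} {f : F} (hf : f ∈ D.sections) (hf0 : f ≠ 0) :
    0 ≤ D.deg := by
  have hfin := finiteDimensional_sections hF hγ P
  obtain ⟨D₁, hD₁⟩ := hγ.1
  -- This choice makes `D + E ≥ D₁`, where `D₁` attains the genus.
  set E := D₁ ⊔ (D₁ - D) with hE
  have h1 := hγ.2 ⟨E, rfl⟩
  have hle : Module.finrank K E.sections ≤ Module.finrank K (D + E).sections := by
    have := hfin (D + E)
    let φ : E.sections →ₗ[K] (D + E).sections :=
      ((LinearMap.mulLeft K f).comp E.sections.subtype).codRestrict _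
        fun g => mul_mem_sections hf g.2
    refine LinearMap.finrank_le_finrank_of_injective (f := φ) fun g g' h => ?_
    exact Subtype.ext (mul_left_cancel₀ hf0 (congrArg Subtype.val h))
  have h2 := (finrank_sections_of_le hF (D := D₁) (E := D + E) (hfin D₁) fun P => by
    have : (D₁ - D) P ≤ E P := le_sup_right (a := D₁ P)
    rw [Finsupp.sub_apply] at this
    rw [Finsupp.add_apply]
    omega).2
  rw [deg_add] at h2
  simp only at h1 hD₁
  omega

/-- Nonzero global sections of negative line bundles do not exist. -/
def DegNonneg (K : Type u) (F : Type v) [Field K] [Field F] [Algebra K F] : Prop :=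
  ∀ (D : CurveDivisor K F) (f : F), f ∈ D.sections → f ≠ 0 → 0 ≤ D.deg

theorem inv_mem_sections {E : CurveDivisor K F} {f : F}
    (hord : ∀ P : Place K F, P.ord f = ((E P : ℤ) : WithTop ℤ)) : f⁻¹ ∈ E.sections := by
  refine mem_sections.2 fun P => ?_
  rw [mem_ordGE, AddValuation.map_inv, hord]
  exact le_rfl

/-- The divisor of zeros of a nonzero section of a line bundle of degree `n` has degree `n`. -/
theorem exists_zeros (hF : DegNonneg K F) {D : CurveDivisor K F} {f : F} (hf : f ∈ D.sections)
    (hf0 : f ≠ 0) : ∃ Z : CurveDivisor K F, (∀ P, 0 ≤ Z P) ∧ Z.deg = D.deg ∧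
      ∀ P : Place K F, P.ord f = ((Z P - D P : ℤ) : WithTop ℤ) := by
  -- The zero divisor is an effective `Z` of maximal degree with `f ∈ H⁰(D - Z)`; maximality makes
  -- all orders exact.
  obtain ⟨n, ⟨Z, hZ, hZn, hfZ⟩, hmax⟩ : ∃ n : ℕ, (∃ Z : CurveDivisor K F, (∀ P, 0 ≤ Z P) ∧
      Z.deg = n ∧ f ∈ (D - Z).sections) ∧ ∀ k : ℕ, (∃ Z : CurveDivisor K F, (∀ P, 0 ≤ Z P) ∧
      Z.deg = k ∧ f ∈ (D - Z).sections) → k ≤ n := by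
    classical
    have hb : ∀ k : ℕ, (∃ Z : CurveDivisor K F, (∀ P, 0 ≤ Z P) ∧
        Z.deg = k ∧ f ∈ (D - Z).sections) → k ≤ D.deg.toNat := by
      rintro k ⟨Z, -, hZ, hfZ⟩
      have := hF _ f hfZ hf0
      rw [deg_sub] at this
      omega
    refine ⟨_, Nat.findGreatest_spec (P := fun k : ℕ => ∃ Z : CurveDivisor K F, (∀ P, 0 ≤ Z P) ∧
        Z.deg = k ∧ f ∈ (D - Z).sections) (Nat.zero_le _) ⟨0, fun _ => le_rfl, deg_zero, ?_⟩,
      fun k hk => Nat.le_findGreatest (hb k hk) hk⟩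
    rwa [sub_zero]
  have hord : ∀ P : Place K F, P.ord f = (((Z - D) P : ℤ) : WithTop ℤ) := by
    intro P
    obtain ⟨k, hk⟩ := P.exists_ord_eq hf0
    have h1 := (mem_ordGE_of_ord_eq hk).1 (mem_sections.1 hfZ P)
    have h2 : ¬ (-((D - Z) P) + 1 ≤ k) := by
      intro h2
      have h3 := mem_sections_sub_single hfZ ((mem_ordGE_of_ord_eq hk).2 h2)
      rw [sub_sub] at h3
      have := hmax (n + 1) ⟨Z + Finsupp.single P 1, fun Q => ?_, ?_, h3⟩
      · omega
      · have : (0 : ℤ) ≤ (Finsupp.single P 1 : CurveDivisor K F) Q := by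
          classical
          rw [Finsupp.single_apply]
          split_ifs <;> omega
        rw [Finsupp.add_apply]
        exact add_nonneg (hZ Q) this
      · rw [deg_add, deg_single, hZn]
        push_cast
        rfl
    rw [hk]
    congr 1
    rw [Finsupp.sub_apply] at *
    omega
  refine ⟨Z, hZ, le_antisymm ?_ ?_, hord⟩
  · have := hF _ f hfZ hf0
    rw [deg_sub] at this
    omega
  -- The inverse of `f` is a section of `𝒪(Z - D)`, which gives the reverse inequality of degrees.
  · have := hF _ _ (inv_mem_sections hord) (inv_ne_zero hf0)
    rw [deg_sub] at this
    omega

/-- A nonzero section of a line bundle of degree `0` has no zeros. -/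
theorem ord_eq_of_deg_eq_zero (hF : DegNonneg K F) {D : CurveDivisor K F} {f : F}
    (hf : f ∈ D.sections) (hf0 : f ≠ 0) (hD : D.deg = 0) (P : Place K F) :
    P.ord f = ((-(D P) : ℤ) : WithTop ℤ) := by
  obtain ⟨Z, hZ, hdeg, hord⟩ := exists_zeros hF hf hf0
  rw [hord, eq_zero_of_deg_eq_zero hZ (hdeg.trans hD), Finsupp.zero_apply, zero_sub]

end CurveDivisor

/-! ### Vanishing sequences of a linear series. -/

section VanishingSequence

variable {K : Type u} {F : Type v} [Field K] [Field F] [Algebra K F]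

/-- Subtracting a multiple of an element of `G` of the same order raises the order of `f`; at the
bound `B` nothing nonzero is left. -/
theorem mem_span_of_orders (hF : HasTrivialResidues K F) {V : Submodule K F} {P : Place K F}
    {B : ℤ} (hB : ∀ f ∈ V, f ∈ P.ordGE B → f = 0) {G : Set F} (hGV : G ⊆ V)
    (hG : ∀ f ∈ V, f ≠ 0 → ∃ g ∈ G, P.ord g = P.ord f) (k : ℕ) :
    ∀ f ∈ V, f ∈ P.ordGE (B - k) → f ∈ Submodule.span K G := by
  induction k with
  | zero =>
    intro f hf hfB
    rw [Nat.cast_zero, sub_zero] at hfB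
    rw [hB f hf hfB]
    exact zero_mem _
  | succ k ih =>
    intro f hf hfB
    by_cases hfk : f ∈ P.ordGE (B - k)
    · exact ih f hf hfk
    have hf0 : f ≠ 0 := by
      rintro rfl
      exact hfk (zero_mem _)
    obtain ⟨n, hn⟩ := P.exists_ord_eq hf0
    rw [mem_ordGE_of_ord_eq hn] at hfB hfk
    obtain ⟨g, hgG, hg⟩ := hG f hf hf0
    obtain ⟨a, ha⟩ := hF.exists_sub_smul_mem ((mem_ordGE_of_ord_eq hn).2 le_rfl) (hg.trans hn)
    have hfg := ih _ (sub_mem hf (V.smul_mem a (hGV hgG))) (P.ordGE_anti (by omega) ha)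
    rw [← sub_add_cancel f (a • g)]
    exact add_mem hfg (Submodule.smul_mem _ a (Submodule.subset_span hgG))

variable {D : CurveDivisor K F} {V : Submodule K F} {P : Place K F}

theorem card_vanishingOrders_le (hfin : FiniteDimensional K V) (S : Finset ℕ)
    (hS : ∀ n ∈ S, HasVanishingOrder D V P n) : S.card ≤ Module.finrank K V := by
  choose g hgV hg0 hg using fun n : S => hS n n.2
  have hli : LinearIndependent K g := by
    refine P.linearIndependent_of_ord_injective g (fun n => ((n : ℕ) : ℤ) - D P) ?_ hg
    intro n n' h
    exact Subtype.ext (by simpa using h)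
  have hli' : LinearIndependent K (fun n : S => (⟨g n, hgV n⟩ : V)) :=
    LinearIndependent.of_comp V.subtype hli
  simpa using hli'.fintype_card_le_finrank

theorem finite_vanishingOrders (hfin : FiniteDimensional K V) :
    (Set.ofPred (HasVanishingOrder D V P)).Finite := by
  by_contra hinf
  obtain ⟨S, hS, hcard⟩ := Set.Infinite.exists_subset_card_eq hinf (Module.finrank K V + 1)
  have := card_vanishingOrders_le hfin S fun n hn => hS hn
  omega

theorem exists_hasVanishingOrder (hV : V ≤ D.sections) {f : F} (hf : f ∈ V) (hf0 : f ≠ 0) :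
    ∃ n : ℕ, HasVanishingOrder D V P n ∧ P.ord f = (((n : ℤ) - D P : ℤ) : WithTop ℤ) := by
  obtain ⟨k, hk⟩ := P.exists_ord_eq hf0
  have := (mem_ordGE_of_ord_eq hk).1 (CurveDivisor.mem_sections.1 (hV hf) P)
  have hk' : P.ord f = ((((k + D P).toNat : ℕ) - D P : ℤ) : WithTop ℤ) := by
    rw [hk]
    congr 1
    omega
  exact ⟨_, ⟨f, hf, hf0, hk'⟩, hk'⟩

/-- A finite-dimensional linear series has as many vanishing orders at a point as its dimension. -/
theorem card_vanishingOrders (hF : HasTrivialResidues K F) (hfin : FiniteDimensional K V)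
    (hV : V ≤ D.sections) (h : (Set.ofPred (HasVanishingOrder D V P)).Finite) :
    h.toFinset.card = Module.finrank K V := by
  classical
  refine le_antisymm (card_vanishingOrders_le hfin _ fun n hn => by simpa using hn) ?_
  choose g hgV hg0 hg using fun n : h.toFinset =>
    (show HasVanishingOrder D V P n from h.mem_toFinset.1 n.2)
  have hspan : V ≤ Submodule.span K (Set.range g) := by
    intro f hf
    by_cases hf0 : f = 0
    · rw [hf0]
      exact zero_mem _
    have hB : ∀ f ∈ V, f ∈ P.ordGE ((h.toFinset.sup id : ℕ) + 1 - D P) → f = 0 := by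
      intro f hf hfB
      by_contra hf0
      obtain ⟨n, hn, hfn⟩ := exists_hasVanishingOrder (P := P) hV hf hf0
      rw [mem_ordGE_of_ord_eq hfn] at hfB
      have : id n ≤ h.toFinset.sup id := Finset.le_sup (by simpa using hn)
      rw [id] at this
      omega
    have key := mem_span_of_orders hF hB (G := Set.range g)
      (by rintro _ ⟨n, rfl⟩; exact hgV n) (by
        intro f hf hf0
        obtain ⟨n, hn, hfn⟩ := exists_hasVanishingOrder (P := P) hV hf hf0
        exact ⟨_, ⟨⟨n, by simpa using hn⟩, rfl⟩, (hg _).trans hfn.symm⟩)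
    obtain ⟨n, hn, hfn⟩ := exists_hasVanishingOrder (P := P) hV hf hf0
    refine key (h.toFinset.sup id + 1) f hf ((mem_ordGE_of_ord_eq hfn).2 ?_)
    push_cast
    omega
  have : FiniteDimensional K (Submodule.span K (Set.range g)) :=
    FiniteDimensional.span_of_finite K (Set.finite_range g)
  have h1 := Submodule.finrank_mono hspan
  have h2 := finrank_range_le_card (R := K) g
  rw [Fintype.card_coe] at h2
  exact h1.trans h2

/-- A linear series of dimension `n` on the curve with the divisor `D`. -/
structure IsLinearSeries (D : CurveDivisor K F) (V : Submodule K F) (n : ℕ) : Prop where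
  le_sections : V ≤ D.sections
  finite : FiniteDimensional K V
  finrank_eq : Module.finrank K V = n

namespace IsLinearSeries

variable {n : ℕ}

theorem hasVanishingOrder_vanishingSeq (hF : HasTrivialResidues K F) (hV : IsLinearSeries D V n)
    (P : Place K F) {i : ℕ} (hi : i < n) : HasVanishingOrder D V P (vanishingSeq D V P i) := by
  have hfin := finite_vanishingOrders (D := D) (P := P) hV.finite
  refine Nat.nth_mem_of_lt_card hfin ?_
  rwa [card_vanishingOrders hF hV.finite hV.le_sections, hV.finrank_eq]

theorem vanishingSeq_strictMonoOn (hF : HasTrivialResidues K F) (hV : IsLinearSeries D V n)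
    (P : Place K F) : StrictMonoOn (vanishingSeq D V P) (Set.Iio n) := by
  have hfin := finite_vanishingOrders (D := D) (P := P) hV.finite
  have := Nat.nth_strictMonoOn hfin
  rwa [card_vanishingOrders hF hV.finite hV.le_sections, hV.finrank_eq] at this

theorem exists_vanishingSeq_eq (hF : HasTrivialResidues K F) (hV : IsLinearSeries D V n)
    {P : Place K F} {k : ℕ} (hk : HasVanishingOrder D V P k) :
    ∃ i < n, vanishingSeq D V P i = k := by
  have hfin := finite_vanishingOrders (D := D) (P := P) hV.finite
  obtain ⟨i, hi, h⟩ := Nat.exists_lt_card_finite_nth_eq hfin hk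
  rw [card_vanishingOrders hF hV.finite hV.le_sections, hV.finrank_eq] at hi
  exact ⟨i, hi, h⟩

/-- There are exactly `n` vanishing orders, so `n` increasing ones are all of them, in order. -/
theorem vanishingSeq_eq (hF : HasTrivialResidues K F) (hV : IsLinearSeries D V n)
    {P : Place K F} {o : ℕ → ℕ} (ho : StrictMonoOn o (Set.Iio n))
    (h : ∀ i < n, HasVanishingOrder D V P (o i)) {i : ℕ} (hi : i < n) :
    vanishingSeq D V P i = o i := by
  have hfin := finite_vanishingOrders (D := D) (P := P) hV.finite
  have hcard := card_vanishingOrders hF hV.finite hV.le_sections hfin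
  rw [hV.finrank_eq] at hcard
  -- This is the domain on which the characterization of `Nat.nth` is stated; for a finite set of
  -- orders it is an initial segment.
  have hset : {n : ℕ | ∀ hf : (Set.ofPred (HasVanishingOrder D V P)).Finite,
      n < hf.toFinset.card} = Set.Iio n := by
    ext k
    simp only [Set.mem_ofPred_eq, Set.mem_Iio]
    exact ⟨fun h => hcard ▸ h hfin, fun h _ => hcard.symm ▸ h⟩
  have hmaps : Set.MapsTo o (Set.Iio n) (Set.ofPred (HasVanishingOrder D V P)) := fun k hk => h k hk
  have hsurj : Set.SurjOn o (Set.Iio n) (Set.ofPred (HasVanishingOrder D V P)) := by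
    have himg : (Finset.range n).image o = hfin.toFinset := by
      refine Finset.eq_of_subset_of_card_le ?_ ?_
      · intro k hk
        obtain ⟨i, hi, rfl⟩ := Finset.mem_image.1 hk
        exact (Set.Finite.mem_toFinset _).2 (h i (Finset.mem_range.1 hi))
      · rw [hcard, Finset.card_image_of_injOn, Finset.card_range]
        intro i hi i' hi'
        exact ho.injOn (by simpa using hi) (by simpa using hi')
    intro k hk
    have : k ∈ (Finset.range n).image o := by
      rw [himg]
      exact (Set.Finite.mem_toFinset _).2 hk
    obtain ⟨i, hi, rfl⟩ := Finset.mem_image.1 this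
    exact ⟨i, by simpa using hi, rfl⟩
  rw [← hset] at hmaps hsurj ho
  exact (Nat.eq_nth_of_strictMonoOn_of_mapsTo_of_surjOn o hsurj hmaps ho
    (hset.symm ▸ (hi : i ∈ Set.Iio n))).symm

theorem exists_ord_eq_vanishingSeq (hF : HasTrivialResidues K F) (hV : IsLinearSeries D V n)
    (P : Place K F) : ∃ g : ℕ → F, ∀ i < n, g i ∈ V ∧ g i ≠ 0 ∧
      P.ord (g i) = (((vanishingSeq D V P i : ℕ) - D P : ℤ) : WithTop ℤ) := by
  have := fun i (hi : i < n) => hV.hasVanishingOrder_vanishingSeq hF P hi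
  choose g hg using this
  classical
  refine ⟨fun i => if hi : i < n then g i hi else 0, fun i hi => ?_⟩
  simp only [dif_pos hi]
  exact hg i hi

/-- The sections vanishing to order at least `a_i` form a subspace of codimension at most `i`. -/
theorem exists_submodule_ordGE (hF : HasTrivialResidues K F) (hV : IsLinearSeries D V n)
    (P : Place K F) {i : ℕ} (hi : i < n) : ∃ U ≤ V, U ≤ P.ordGE (vanishingSeq D V P i - D P) ∧
      Module.finrank K U + i = n := by
  obtain ⟨g, hg⟩ := hV.exists_ord_eq_vanishingSeq hF P
  have hlt : ∀ j : Fin (n - i), i + j < n := fun j => by omega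
  have hmono := hV.vanishingSeq_strictMonoOn hF P
  have hli : LinearIndependent K fun j : Fin (n - i) => g (i + j) := by
    refine P.linearIndependent_of_ord_injective _
      (fun j => ((vanishingSeq D V P (i + j) : ℕ) : ℤ) - D P) ?_ fun j => (hg _ (hlt j)).2.2
    intro j j' h
    have h1 : vanishingSeq D V P (i + j) = vanishingSeq D V P (i + j') := by
      simpa using h
    have h2 := hmono.injOn (hlt j) (hlt j') h1
    exact Fin.ext (by omega)
  refine ⟨Submodule.span K (Set.range fun j : Fin (n - i) => g (i + j)), ?_, ?_, ?_⟩
  · rw [Submodule.span_le]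
    rintro _ ⟨j, rfl⟩
    exact (hg _ (hlt j)).1
  · rw [Submodule.span_le]
    rintro _ ⟨j, rfl⟩
    refine (mem_ordGE_of_ord_eq (hg _ (hlt j)).2.2).2 ?_
    have := hmono.monotoneOn (show i ∈ Set.Iio n from hi) (hlt j) (by omega)
    omega
  · rw [finrank_span_eq_card hli, Fintype.card_fin]
    omega

/-- The two subspaces cut out by the order conditions have codimensions `i` and `j` in `V`, so they
meet nontrivially when `i + j < n`. -/
theorem exists_mem_of_vanishingSeq (hF : HasTrivialResidues K F) (hV : IsLinearSeries D V n)
    (p q : Place K F) {i j : ℕ} (hij : i + j < n) : ∃ f ∈ V, f ≠ 0 ∧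
      f ∈ p.ordGE (vanishingSeq D V p i - D p) ∧ f ∈ q.ordGE (vanishingSeq D V q j - D q) := by
  obtain ⟨U, hUV, hUp, hU⟩ := hV.exists_submodule_ordGE hF p (i := i) (by omega)
  obtain ⟨U', hUV', hUq, hU'⟩ := hV.exists_submodule_ordGE hF q (i := j) (by omega)
  have := hV.finite
  have hfU : FiniteDimensional K U := Submodule.finiteDimensional_of_le hUV
  have hfU' : FiniteDimensional K U' := Submodule.finiteDimensional_of_le hUV'
  have h1 := Submodule.finrank_sup_add_finrank_inf_eq U U'
  have h2 := Submodule.finrank_mono (sup_le hUV hUV')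
  rw [hV.finrank_eq] at h2
  have h3 : U ⊓ U' ≠ ⊥ := by
    intro h
    rw [h, finrank_bot] at h1
    omega
  obtain ⟨f, hf, hf0⟩ := Submodule.exists_mem_ne_zero_of_ne_bot h3
  exact ⟨f, hUV hf.1, hf0, hUp hf.1, hUq hf.2⟩

end IsLinearSeries

end VanishingSequence

/-! ### Two marked points: degree bounds, nontorsion and adapted bases. -/

section TwoPointed

variable {K : Type u} {F : Type v} [Field K] [Field F] [Algebra K F]
variable {D B : CurveDivisor K F} {V W : Submodule K F} {p q : Place K F}

theorem mem_sections_sub_marked (hpq : p ≠ q) (hBp : B p = 0) (hBq : B q = 0) {f : F}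
    (hf : f ∈ (D - B).sections) {x y : ℤ} (hp : f ∈ p.ordGE (x - D p))
    (hq : f ∈ q.ordGE (y - D q)) :
    f ∈ (D - B - Finsupp.single p x - Finsupp.single q y).sections := by
  classical
  refine mem_sections.2 fun P => ?_
  simp only [Finsupp.sub_apply, Finsupp.single_apply]
  by_cases hP : p = P
  · subst hP
    rw [if_pos rfl, if_neg hpq.symm, hBp]
    convert hp using 2
    ring
  · by_cases hQ : q = P
    · subst hQ
      rw [if_neg hP, if_pos rfl, hBq]
      convert hq using 2
      ring
    · rw [if_neg hP, if_neg hQ]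
      have := mem_sections.1 hf P
      rw [Finsupp.sub_apply] at this
      convert this using 2
      ring

theorem deg_sub_marked (x y : ℤ) :
    (D - B - Finsupp.single p x - Finsupp.single q y).deg = D.deg - B.deg - x - y := by
  simp only [deg_sub, deg_single]

/-- The zeros at `p`, at `q` and along `B` are disjoint, so together they number at most the degree.
-/
theorem add_add_deg_le (hF : DegNonneg K F) (hpq : p ≠ q) (hBp : B p = 0) (hBq : B q = 0) {f : F}
    (hf0 : f ≠ 0) (hf : f ∈ (D - B).sections) {x y : ℤ} (hp : f ∈ p.ordGE (x - D p))
    (hq : f ∈ q.ordGE (y - D q)) : x + y + B.deg ≤ D.deg := by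
  have := hF _ _ (mem_sections_sub_marked hpq hBp hBq hf hp hq) hf0
  rw [deg_sub_marked] at this
  omega

/-- The marked points of a curve have nontorsion difference. -/
def NontorsionDifference (p q : Place K F) : Prop :=
  ∀ n : ℤ, n ≠ 0 → ¬ IsPrincipal (Finsupp.single p n - Finsupp.single q n)

/-- Equality in the degree bound leaves no further zeros for either section. Their quotient then has
divisor (x - x')(p - q), which nontorsion forbids unless x = x'. -/
theorem NontorsionDifference.eq_of_deg_eq (hpq' : NontorsionDifference p q) (hF : DegNonneg K F)
    (hpq : p ≠ q) (hBp : B p = 0) (hBq : B q = 0) {f f' : F} (hf0 : f ≠ 0) (hf'0 : f' ≠ 0)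
    (hf : f ∈ (D - B).sections) (hf' : f' ∈ (D - B).sections) {x y x' y' : ℤ}
    (hp : f ∈ p.ordGE (x - D p)) (hq : f ∈ q.ordGE (y - D q))
    (hp' : f' ∈ p.ordGE (x' - D p)) (hq' : f' ∈ q.ordGE (y' - D q))
    (h : x + y + B.deg = D.deg) (h' : x' + y' + B.deg = D.deg) : x = x' := by
  by_contra hne
  refine hpq' (x - x') (sub_ne_zero.2 hne) ⟨f / f', div_ne_zero hf0 hf'0, fun P => ?_⟩
  have h1 := ord_eq_of_deg_eq_zero hF (mem_sections_sub_marked hpq hBp hBq hf hp hq) hf0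
    (by rw [deg_sub_marked]; omega) P
  have h2 := ord_eq_of_deg_eq_zero hF (mem_sections_sub_marked hpq hBp hBq hf' hp' hq') hf'0
    (by rw [deg_sub_marked]; omega) P
  obtain ⟨k, hk⟩ := P.exists_ord_eq (div_ne_zero hf0 hf'0)
  have h3 : P.ord (f / f' * f') = P.ord f := by rw [div_mul_cancel₀ _ hf'0]
  rw [AddValuation.map_mul, hk, h1, h2, ← WithTop.coe_add, WithTop.coe_eq_coe] at h3
  rw [hk]
  congr 1
  classical
  simp only [Finsupp.sub_apply, Finsupp.single_apply] at h3 ⊢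
  split_ifs at h3 ⊢ <;> omega

/-- A linear series with vanishing sequences `a i` and `m - a' (r - i)` at the two marked points,
together with a basis `f` adapted to both of them. -/
structure AdaptedFrame (D : CurveDivisor K F) (V : Submodule K F) (p q : Place K F) (r m : ℕ)
    (a a' : ℕ → ℕ) (f : ℕ → F) : Prop where
  p_ne_q : p ≠ q
  deg_eq : D.deg = m
  series : IsLinearSeries D V (r + 1)
  mono_left : StrictMono a
  mono_right : StrictMono a'
  seq_p : ∀ i ≤ r, vanishingSeq D V p i = a i
  seq_q : ∀ i ≤ r, (vanishingSeq D V q (r - i) : ℤ) = m - a' i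
  mem : ∀ i ≤ r, f i ∈ V
  ne_zero : ∀ i ≤ r, f i ≠ 0
  ord_p : ∀ i ≤ r, p.ord (f i) = ((a i - D p : ℤ) : WithTop ℤ)
  ord_q : ∀ i ≤ r, q.ord (f i) = ((m - a' i - D q : ℤ) : WithTop ℤ)

theorem exists_mem_ord_eq (hres : HasTrivialResidues K F) (hF : DegNonneg K F) (hpq : p ≠ q)
    {r m : ℕ} (hD : D.deg = m) (hV : IsLinearSeries D V (r + 1)) {i : ℕ} (hi : i ≤ r) {x y : ℤ}
    (hx : (vanishingSeq D V p i : ℤ) = x) (hy : (vanishingSeq D V q (r - i) : ℤ) = y) :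
    ∃ f ∈ V, f ≠ 0 ∧ ∃ x' y' : ℤ, x ≤ x' ∧ y ≤ y' ∧ x' + y' ≤ m ∧
      p.ord f = ((x' - D p : ℤ) : WithTop ℤ) ∧ q.ord f = ((y' - D q : ℤ) : WithTop ℤ) := by
  obtain ⟨f, hfV, hf0, hfp, hfq⟩ := hV.exists_mem_of_vanishingSeq hres p q (i := i) (j := r - i)
    (by omega)
  rw [hx] at hfp
  rw [hy] at hfq
  obtain ⟨k, hk⟩ := p.exists_ord_eq hf0
  obtain ⟨l, hl⟩ := q.exists_ord_eq hf0
  rw [mem_ordGE_of_ord_eq hk] at hfp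
  rw [mem_ordGE_of_ord_eq hl] at hfq
  have := add_add_deg_le (D := D) (B := 0) (x := k + D p) (y := l + D q) hF hpq rfl rfl hf0
    (by rw [sub_zero]; exact hV.le_sections hfV)
    ((mem_ordGE_of_ord_eq hk).2 (by omega)) ((mem_ordGE_of_ord_eq hl).2 (by omega))
  rw [deg_zero] at this
  exact ⟨f, hfV, hf0, k + D p, l + D q, by omega, by omega, by omega, by rw [hk]; congr 1; omega,
    by rw [hl]; congr 1; omega⟩

theorem exists_adaptedFrame_of_exists (hpq : p ≠ q)
    {r m : ℕ} (hD : D.deg = m) (hV : IsLinearSeries D V (r + 1)) {a a' : ℕ → ℕ} (ha : StrictMono a)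
    (ha' : StrictMono a') (hp : ∀ i ≤ r, vanishingSeq D V p i = a i)
    (hq : ∀ i ≤ r, (vanishingSeq D V q (r - i) : ℤ) = m - a' i)
    (h : ∀ i ≤ r, ∃ f ∈ V, f ≠ 0 ∧ p.ord f = ((a i - D p : ℤ) : WithTop ℤ) ∧
      q.ord f = ((m - a' i - D q : ℤ) : WithTop ℤ)) :
    ∃ f, AdaptedFrame D V p q r m a a' f := by
  choose f hfV hf0 hfp hfq using h
  classical
  refine ⟨fun i => if hi : i ≤ r then f i hi else 0, hpq, hD, hV, ha, ha', hp, hq, ?_, ?_, ?_, ?_⟩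
  all_goals
    intro i hi
    simp only [dif_pos hi]
  · exact hfV i hi
  · exact hf0 i hi
  · exact hfp i hi
  · exact hfq i hi

theorem exists_adaptedFrame_of_eq (hres : HasTrivialResidues K F) (hF : DegNonneg K F) (hpq : p ≠ q)
    {r m : ℕ} (hD : D.deg = m) (hV : IsLinearSeries D V (r + 1)) {a : ℕ → ℕ} (ha : StrictMono a)
    (hp : ∀ i ≤ r, vanishingSeq D V p i = a i)
    (hq : ∀ i ≤ r, (vanishingSeq D V q (r - i) : ℤ) = m - a i) :
    ∃ f, AdaptedFrame D V p q r m a a f := by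
  refine exists_adaptedFrame_of_exists hpq hD hV ha ha hp hq fun i hi => ?_
  obtain ⟨f, hfV, hf0, x, y, hx, hy, hxy, hfp, hfq⟩ := exists_mem_ord_eq hres hF hpq hD hV hi
    (congrArg Nat.cast (hp i hi)) (hq i hi)
  obtain rfl : x = a i := by omega
  obtain rfl : y = m - a i := by omega
  exact ⟨f, hfV, hf0, hfp, hfq⟩

/-- For `i ≠ w` the prescribed orders add up to m - 1, so a section with larger orders would have
total m. By nontorsion its order at `p` would be that of the aligned section of index `w`, against
the strict monotonicity of `a` or of `a'`. -/
theorem exists_adaptedFrame_of_nontorsion (hres : HasTrivialResidues K F) (hF : DegNonneg K F)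
    (hpq : p ≠ q) (hpq' : NontorsionDifference p q)
    {r m : ℕ} (hD : D.deg = m) (hV : IsLinearSeries D V (r + 1)) {a a' : ℕ → ℕ} (ha : StrictMono a)
    (ha' : StrictMono a') (hp : ∀ i ≤ r, vanishingSeq D V p i = a i)
    (hq : ∀ i ≤ r, (vanishingSeq D V q (r - i) : ℤ) = m - a' i) {w : ℕ} (hw : w ≤ r)
    (haw : a' w = a w) (haa' : ∀ i ≤ r, i ≠ w → a' i = a i + 1) :
    ∃ f, AdaptedFrame D V p q r m a a' f := by
  refine exists_adaptedFrame_of_exists hpq hD hV ha ha' hp hq fun i hi => ?_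
  obtain ⟨f, hfV, hf0, x, y, hx, hy, hxy, hfp, hfq⟩ := exists_mem_ord_eq hres hF hpq hD hV hi
    (congrArg Nat.cast (hp i hi)) (hq i hi)
  suffices h : x = a i ∧ y = m - a' i by
    obtain ⟨rfl, rfl⟩ := h
    exact ⟨f, hfV, hf0, hfp, hfq⟩
  by_cases hiw : i = w
  · subst hiw
    omega
  have hi' := haa' i hi hiw
  by_contra hcon
  obtain ⟨f', hfV', hf0', x', y', hx', hy', hxy', hfp', hfq'⟩ := exists_mem_ord_eq hres hF hpq hD hV
    hw (congrArg Nat.cast (hp w hw)) (hq w hw)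
  have hsec : ∀ g ∈ V, g ∈ (D - 0).sections := fun g hg => by
    rw [sub_zero]
    exact hV.le_sections hg
  have := hpq'.eq_of_deg_eq (D := D) (B := 0) hF hpq rfl rfl hf0 hf0' (hsec f hfV) (hsec f' hfV')
    ((mem_ordGE_of_ord_eq hfp).2 le_rfl) ((mem_ordGE_of_ord_eq hfq).2 le_rfl)
    ((mem_ordGE_of_ord_eq hfp').2 le_rfl) ((mem_ordGE_of_ord_eq hfq').2 le_rfl)
    (by rw [deg_zero]; omega) (by rw [deg_zero]; omega)
  rcases eq_or_ne x (a i) with hxi | hxi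
  · exact hiw (ha.injective (by omega))
  · exact hiw (ha'.injective (by omega))

namespace AdaptedFrame

variable {r m : ℕ} {a a' : ℕ → ℕ} {f : ℕ → F}

theorem exists_sum (h : AdaptedFrame D V p q r m a a' f) {s : F} (hs : s ∈ V) :
    ∃ c : ℕ → K, s = ∑ i ∈ Finset.range (r + 1), c i • f i := by
  have hli : LinearIndependent K fun i : Fin (r + 1) => f i := by
    refine p.linearIndependent_of_ord_injective _ (fun i : Fin (r + 1) => ((a i : ℕ) : ℤ) - D p) ?_
      fun i => h.ord_p i (by omega)
    intro i j hij
    have hij' : a i = a j := by simpa using hij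
    exact Fin.ext (h.mono_left.injective hij')
  have hle : Submodule.span K (Set.range fun i : Fin (r + 1) => f i) ≤ V := by
    rw [Submodule.span_le]
    rintro _ ⟨i, rfl⟩
    exact h.mem i (by omega)
  have := h.series.finite
  have heq := Submodule.eq_of_le_of_finrank_eq hle
    (by rw [finrank_span_eq_card hli, Fintype.card_fin, h.series.finrank_eq])
  rw [← heq, Submodule.mem_span_range_iff_exists_fun] at hs
  obtain ⟨c, hc⟩ := hs
  refine ⟨fun i => if hi : i < r + 1 then c ⟨i, hi⟩ else 0, ?_⟩
  rw [← hc, Finset.sum_range]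
  refine Finset.sum_congr rfl fun i _ => ?_
  simp only [dif_pos i.2]

/-- A section whose vanishing orders are bounded below at both points involves only the
corresponding part of the adapted basis. -/
theorem exists_sum_Icc (h : AdaptedFrame D V p q r m a a' f) {s : F} (hs : s ∈ V) {i j : ℕ}
    (hj : j ≤ r) (hp : s ∈ p.ordGE (a i - D p)) (hq : s ∈ q.ordGE (m - a' j - D q)) :
    ∃ c : ℕ → K, s = ∑ l ∈ Finset.Icc i j, c l • f l := by
  obtain ⟨c, hc⟩ := h.exists_sum hs
  refine ⟨c, ?_⟩
  rw [hc]
  symm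
  refine Finset.sum_subset (fun l hl => ?_) fun l hl hl' => ?_
  · rw [Finset.mem_Icc] at hl
    rw [Finset.mem_range]
    omega
  · rw [Finset.mem_range] at hl
    by_contra hcl
    have hcl0 : c l ≠ 0 := fun h0 => hcl (by rw [h0, zero_smul])
    -- A nonzero coefficient at `l` caps the order by that of `f l` at both points, which forces `i
    -- ≤ l ≤ j`.
    have h1 := p.ord_sum_smul_le (Finset.range (r + 1)) f (fun i => (a i : ℤ) - D p)
      (fun i _ j _ hij => h.mono_left.injective (by simpa using hij))
      (fun i hi => h.ord_p i (by rw [Finset.mem_range] at hi; omega)) c (Finset.mem_range.2 hl) hcl0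
    have h2 := q.ord_sum_smul_le (Finset.range (r + 1)) f (fun i => (m : ℤ) - a' i - D q)
      (fun i _ j _ hij => h.mono_right.injective (by simpa using hij))
      (fun i hi => h.ord_q i (by rw [Finset.mem_range] at hi; omega)) c (Finset.mem_range.2 hl) hcl0
    rw [← hc] at h1 h2
    have h3 := WithTop.coe_le_coe.1 ((mem_ordGE.1 hp).trans h1)
    have h4 := WithTop.coe_le_coe.1 ((mem_ordGE.1 hq).trans h2)
    have h5 : i ≤ l := h.mono_left.le_iff_le.1 (by omega)
    have h6 : l ≤ j := h.mono_right.le_iff_le.1 (by omega)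
    exact hl' (Finset.mem_Icc.2 ⟨h5, h6⟩)

theorem exists_eq_smul (h : AdaptedFrame D V p q r m a a' f) {s : F} (hs : s ∈ V) {i : ℕ}
    (hi : i ≤ r) (hp : s ∈ p.ordGE (a i - D p)) (hq : s ∈ q.ordGE (m - a' i - D q)) :
    ∃ c : K, s = c • f i := by
  obtain ⟨c, hc⟩ := h.exists_sum_Icc hs hi hp hq
  exact ⟨c i, by rw [hc, Finset.Icc_self, Finset.sum_singleton]⟩

theorem exists_eq_smul_add_smul (h : AdaptedFrame D V p q r m a a' f) {s : F} (hs : s ∈ V) {i : ℕ}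
    (hi : i + 1 ≤ r) (hp : s ∈ p.ordGE (a i - D p)) (hq : s ∈ q.ordGE (m - a' (i + 1) - D q)) :
    ∃ c c' : K, s = c • f i + c' • f (i + 1) := by
  obtain ⟨c, hc⟩ := h.exists_sum_Icc hs hi hp hq
  refine ⟨c i, c (i + 1), ?_⟩
  rw [hc, Finset.sum_Icc_succ_top (by omega), Finset.Icc_self, Finset.sum_singleton]

theorem le_of_mem_ordGE (h : AdaptedFrame D V p q r m a a' f) {s : F} (hs : s ∈ V) (hs0 : s ≠ 0)
    {i j : ℕ} (hj : j ≤ r) (hp : s ∈ p.ordGE (a i - D p)) (hq : s ∈ q.ordGE (m - a' j - D q)) :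
    i ≤ j := by
  obtain ⟨c, hc⟩ := h.exists_sum_Icc hs hj hp hq
  by_contra hij
  rw [Finset.Icc_eq_empty hij, Finset.sum_empty] at hc
  exact hs0 hc

/-- The vanishing sequences of a subseries are subsequences of those of the ambient series. -/
theorem exists_indices (hres : HasTrivialResidues K F) (h : AdaptedFrame D V p q r m a a' f)
    {t : ℕ} (hW : IsLinearSeries D W (t + 1)) (hWV : W ≤ V) :
    ∃ σ τ : ℕ → ℕ, StrictMonoOn σ (Set.Iic t) ∧ StrictMonoOn τ (Set.Iic t) ∧
      ∀ k ≤ t, σ k ≤ τ k ∧ τ k ≤ r ∧ vanishingSeq D W p k = a (σ k) ∧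
        (vanishingSeq D W q (t - k) : ℤ) = m - a' (τ k) := by
  have hsub : ∀ (P : Place K F) (i : ℕ), HasVanishingOrder D W P i → HasVanishingOrder D V P i :=
    fun P i ⟨g, hg, h⟩ => ⟨g, hWV hg, h⟩
  have hσ : ∀ k, ∃ i, k ≤ t → i ≤ r ∧ vanishingSeq D W p k = a i := by
    intro k
    by_cases hk : k ≤ t
    · obtain ⟨i, hi, hik⟩ := h.series.exists_vanishingSeq_eq hres
        (hsub p _ (hW.hasVanishingOrder_vanishingSeq hres p (i := k) (by omega)))
      exact ⟨i, fun _ => ⟨by omega, by rw [← hik, h.seq_p i (by omega)]⟩⟩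
    · exact ⟨0, fun h => absurd h hk⟩
  have hτ : ∀ k, ∃ i, k ≤ t → i ≤ r ∧ (vanishingSeq D W q (t - k) : ℤ) = m - a' i := by
    intro k
    by_cases hk : k ≤ t
    · obtain ⟨i, hi, hik⟩ := h.series.exists_vanishingSeq_eq hres
        (hsub q _ (hW.hasVanishingOrder_vanishingSeq hres q (i := t - k) (by omega)))
      refine ⟨r - i, fun _ => ⟨by omega, ?_⟩⟩
      rw [← h.seq_q (r - i) (by omega), ← hik]
      congr 2
      omega
    · exact ⟨0, fun h => absurd h hk⟩
  choose σ hσ using hσ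
  choose τ hτ using hτ
  have hmp := hW.vanishingSeq_strictMonoOn hres p
  have hmq := hW.vanishingSeq_strictMonoOn hres q
  refine ⟨σ, τ, ?_, ?_, fun k hk => ⟨?_, (hτ k hk).1, (hσ k hk).2, (hτ k hk).2⟩⟩
  · intro k hk l hl hkl
    rw [Set.mem_Iic] at hk hl
    have := hmp (Set.mem_Iio.2 (by omega : k < t + 1)) (Set.mem_Iio.2 (by omega : l < t + 1)) hkl
    rw [(hσ k hk).2, (hσ l hl).2] at this
    exact h.mono_left.lt_iff_lt.1 this
  · intro k hk l hl hkl
    rw [Set.mem_Iic] at hk hl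
    have := hmq (Set.mem_Iio.2 (by omega : t - l < t + 1))
      (Set.mem_Iio.2 (by omega : t - k < t + 1)) (by omega)
    have h1 := (hτ k hk).2
    have h2 := (hτ l hl).2
    exact h.mono_right.lt_iff_lt.1 (by omega)
  -- A nonzero section of `W` satisfying the `k`-th order conditions at both points involves only
  -- basis members with indices from `σ k` to `τ k`.
  · obtain ⟨s, hsW, hs0, hsp, hsq⟩ := hW.exists_mem_of_vanishingSeq hres p q (i := k) (j := t - k)
      (by omega)
    rw [(hσ k hk).2] at hsp
    rw [(hτ k hk).2] at hsq
    exact h.le_of_mem_ordGE (hWV hsW) hs0 (hτ k hk).1 hsp hsq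

/-- This is the degree bound for a section of `W` satisfying the `k`-th conditions at both points;
it is the inequality that drives the index count. -/
theorem index_add_deg_le (hres : HasTrivialResidues K F) (hF : DegNonneg K F)
    (h : AdaptedFrame D V p q r m a a' f) {t : ℕ} (hW : IsLinearSeries D W (t + 1))
    (hWB : W ≤ (D - B).sections) (hBp : B p = 0) (hBq : B q = 0) {k i j : ℕ} (hk : k ≤ t)
    (hi : vanishingSeq D W p k = a i) (hj : (vanishingSeq D W q (t - k) : ℤ) = m - a' j) :
    (a i : ℤ) + B.deg ≤ a' j := by
  obtain ⟨s, hsW, hs0, hsp, hsq⟩ := hW.exists_mem_of_vanishingSeq hres p q (i := k) (j := t - k)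
    (by omega)
  rw [hi] at hsp
  rw [hj] at hsq
  have := add_add_deg_le hF h.p_ne_q hBp hBq hs0 (hWB hsW) hsp hsq
  rw [h.deg_eq] at this
  omega

/-- By nontorsion at most one `k` attains equality in `index_add_deg_le`. -/
theorem index_eq_of_add_deg_eq (hres : HasTrivialResidues K F) (hF : DegNonneg K F)
    (h : AdaptedFrame D V p q r m a a' f) (hpq' : NontorsionDifference p q) {t : ℕ}
    (hW : IsLinearSeries D W (t + 1))
    (hWB : W ≤ (D - B).sections) (hBp : B p = 0) (hBq : B q = 0) {k i j k' i' j' : ℕ} (hk : k ≤ t)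
    (hi : vanishingSeq D W p k = a i) (hj : (vanishingSeq D W q (t - k) : ℤ) = m - a' j)
    (hk' : k' ≤ t) (hi' : vanishingSeq D W p k' = a i')
    (hj' : (vanishingSeq D W q (t - k') : ℤ) = m - a' j')
    (heq : (a i : ℤ) + B.deg = a' j) (heq' : (a i' : ℤ) + B.deg = a' j') : i = i' := by
  obtain ⟨s, hsW, hs0, hsp, hsq⟩ := hW.exists_mem_of_vanishingSeq hres p q (i := k) (j := t - k)
    (by omega)
  obtain ⟨s', hsW', hs0', hsp', hsq'⟩ := hW.exists_mem_of_vanishingSeq hres p q (i := k')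
    (j := t - k') (by omega)
  rw [hi] at hsp
  rw [hj] at hsq
  rw [hi'] at hsp'
  rw [hj'] at hsq'
  have := hpq'.eq_of_deg_eq hF h.p_ne_q hBp hBq hs0 hs0' (hWB hsW) (hWB hsW') hsp hsq hsp' hsq'
    (by rw [h.deg_eq]; omega) (by rw [h.deg_eq]; omega)
  exact h.mono_left.injective (by omega)

end AdaptedFrame

end TwoPointed

/-! ### Existence and uniqueness of the subseries on one component. -/

section LocalInclusion

variable {K : Type u} {F : Type v} [Field K] [Field F] [Algebra K F]

/-- A subseries `W` of `V` with base divisor `B` whose vanishing sequences are the subsequences of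
those of `V` given by the indices `σ` and `τ`. -/
structure IsLocalInclusion (D : CurveDivisor K F) (V : Submodule K F) (p q : Place K F) (t m : ℕ)
    (a a' σ τ : ℕ → ℕ) (B : CurveDivisor K F) (W : Submodule K F) : Prop where
  effective : ∀ P, 0 ≤ B P
  base_p : B p = 0
  base_q : B q = 0
  le_ambient : W ≤ V
  vanish_on_base : W ≤ (D - B).sections
  series : IsLinearSeries D W (t + 1)
  seq_p : ∀ k ≤ t, vanishingSeq D W p k = a (σ k)
  seq_q : ∀ k ≤ t, (vanishingSeq D W q (t - k) : ℤ) = m - a' (τ k)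

variable {D B : CurveDivisor K F} {V W : Submodule K F} {p q : Place K F}
  {r m t : ℕ} {a a' σ τ : ℕ → ℕ} {f G : ℕ → F}

namespace AdaptedFrame

/-- Distinct orders make the `G k` independent, and their t + 1 orders at each marked point exhaust
the vanishing sequence there. -/
theorem isLocalInclusion_span (hres : HasTrivialResidues K F)
    (h : AdaptedFrame D V p q r m a a' f) (hσ : StrictMonoOn σ (Set.Iic t))
    (hτ : StrictMonoOn τ (Set.Iic t)) (hτr : ∀ k ≤ t, τ k ≤ r)
    (hB : ∀ P, 0 ≤ B P) (hBp : B p = 0) (hBq : B q = 0)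
    (hGV : ∀ k ≤ t, G k ∈ V) (hGB : ∀ k ≤ t, G k ∈ (D - B).sections)
    (hGp : ∀ k ≤ t, p.ord (G k) = ((a (σ k) - D p : ℤ) : WithTop ℤ))
    (hGq : ∀ k ≤ t, q.ord (G k) = ((m - a' (τ k) - D q : ℤ) : WithTop ℤ)) :
    IsLocalInclusion D V p q t m a a' σ τ B (Submodule.span K (G '' Set.Iic t)) := by
  have hle : ∀ U : Submodule K F, (∀ k ≤ t, G k ∈ U) → Submodule.span K (G '' Set.Iic t) ≤ U := by
    intro U hU
    rw [Submodule.span_le]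
    rintro _ ⟨k, hk, rfl⟩
    exact hU k hk
  have hmem : ∀ k ≤ t, G k ∈ Submodule.span K (G '' Set.Iic t) := fun k hk =>
    Submodule.subset_span ⟨k, hk, rfl⟩
  have hG0 : ∀ k ≤ t, G k ≠ 0 := by
    intro k hk h0
    have := hGp k hk
    rw [h0, AddValuation.map_zero] at this
    exact WithTop.coe_ne_top this.symm
  have hWV := hle V hGV
  have hfin : FiniteDimensional K V := h.series.finite
  have hrange : G '' Set.Iic t = Set.range fun k : Fin (t + 1) => G k := by
    ext x
    constructor
    · rintro ⟨k, hk, rfl⟩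
      exact ⟨⟨k, Nat.lt_succ_of_le hk⟩, rfl⟩
    · rintro ⟨k, rfl⟩
      exact ⟨k, Nat.le_of_lt_succ k.2, rfl⟩
  have hli : LinearIndependent K fun k : Fin (t + 1) => G k := by
    refine p.linearIndependent_of_ord_injective _
      (fun k : Fin (t + 1) => ((a (σ k) : ℕ) : ℤ) - D p) ?_ fun k => hGp k (by omega)
    intro k l hkl
    have h1 : a (σ k) = a (σ l) := by simpa using hkl
    exact Fin.ext (hσ.injOn (Set.mem_Iic.2 (by omega)) (Set.mem_Iic.2 (by omega))
      (h.mono_left.injective h1))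
  have hW : IsLinearSeries D (Submodule.span K (G '' Set.Iic t)) (t + 1) := by
    refine ⟨hWV.trans h.series.le_sections, Submodule.finiteDimensional_of_le hWV, ?_⟩
    rw [hrange, finrank_span_eq_card hli, Fintype.card_fin]
  refine ⟨hB, hBp, hBq, hWV, hle _ hGB, hW, fun k hk => ?_, fun k hk => ?_⟩
  · refine hW.vanishingSeq_eq hres (o := fun k => a (σ k)) ?_ (fun k hk => ?_)
      (Nat.lt_succ_of_le hk)
    · intro k hk l hl hkl
      exact h.mono_left (hσ (Set.mem_Iic.2 (Nat.le_of_lt_succ hk))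
        (Set.mem_Iic.2 (Nat.le_of_lt_succ hl)) hkl)
    · exact ⟨G k, hmem k (by omega), hG0 k (by omega), hGp k (by omega)⟩
  · have hle' : ∀ k ≤ t, ((m - a' (τ k) : ℕ) : ℤ) = m - a' (τ k) := by
      intro k hk
      have := h.seq_q (τ k) (hτr k hk)
      omega
    rw [hW.vanishingSeq_eq hres (o := fun k => m - a' (τ (t - k))) ?_ (fun k hk => ?_)
      (by omega : t - k < t + 1)]
    · rw [hle' _ (by omega)]
      congr 4
      omega
    · intro k hk l hl hkl
      rw [Set.mem_Iio] at hk hl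
      have h1 := h.mono_right (hτ (Set.mem_Iic.2 (by omega : t - l ≤ t))
        (Set.mem_Iic.2 (by omega : t - k ≤ t)) (by omega))
      have h2 := hle' (t - k) (by omega)
      have h3 := hle' (t - l) (by omega)
      simp only
      omega
    · refine ⟨G (t - k), hmem _ (by omega), hG0 _ (by omega), ?_⟩
      rw [hle' _ (by omega)]
      exact hGq _ (by omega)

/-- For each `k` a dimension count gives a section of `W` meeting the `k`-th conditions, which by
`hG` is a multiple of `G k`. So `W` contains the span, and the dimensions agree. -/
theorem eq_span_of_isLocalInclusion (hres : HasTrivialResidues K F)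
    (h : AdaptedFrame D V p q r m a a' f) (hσ : StrictMonoOn σ (Set.Iic t))
    (hGp : ∀ k ≤ t, p.ord (G k) = ((a (σ k) - D p : ℤ) : WithTop ℤ))
    (hG : ∀ k ≤ t, ∀ s ∈ V, s ∈ (D - B).sections → s ∈ p.ordGE (a (σ k) - D p) →
      s ∈ q.ordGE (m - a' (τ k) - D q) → ∃ c : K, s = c • G k)
    (hW : IsLocalInclusion D V p q t m a a' σ τ B W) :
    W = Submodule.span K (G '' Set.Iic t) := by
  have hGW : ∀ k ≤ t, G k ∈ W := by
    intro k hk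
    obtain ⟨s, hsW, hs0, hsp, hsq⟩ := hW.series.exists_mem_of_vanishingSeq hres p q (i := k)
      (j := t - k) (by omega)
    rw [hW.seq_p k hk] at hsp
    rw [hW.seq_q k hk] at hsq
    obtain ⟨c, rfl⟩ := hG k hk s (hW.le_ambient hsW) (hW.vanish_on_base hsW) hsp hsq
    have hc : c ≠ 0 := by
      rintro rfl
      exact hs0 (zero_smul _ _)
    have := W.smul_mem c⁻¹ hsW
    rwa [smul_smul, inv_mul_cancel₀ hc, one_smul] at this
  have hli : LinearIndependent K fun k : Fin (t + 1) => G k := by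
    refine p.linearIndependent_of_ord_injective _
      (fun k : Fin (t + 1) => ((a (σ k) : ℕ) : ℤ) - D p) ?_ fun k => hGp k (by omega)
    intro k l hkl
    have h1 : a (σ k) = a (σ l) := by simpa using hkl
    exact Fin.ext (hσ.injOn (Set.mem_Iic.2 (by omega)) (Set.mem_Iic.2 (by omega))
      (h.mono_left.injective h1))
  have hrange : G '' Set.Iic t = Set.range fun k : Fin (t + 1) => G k := by
    ext x
    constructor
    · rintro ⟨k, hk, rfl⟩
      exact ⟨⟨k, Nat.lt_succ_of_le hk⟩, rfl⟩
    · rintro ⟨k, rfl⟩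
      exact ⟨k, Nat.le_of_lt_succ k.2, rfl⟩
  have := hW.series.finite
  symm
  refine Submodule.eq_of_le_of_finrank_eq ?_ ?_
  · rw [Submodule.span_le]
    rintro _ ⟨k, hk, rfl⟩
    exact hGW k hk
  · rw [hrange, finrank_span_eq_card hli, Fintype.card_fin, hW.series.finrank_eq]

/-- Without base points, a local inclusion is spanned by members of the adapted basis. -/
theorem existsUnique_isLocalInclusion_zero (hres : HasTrivialResidues K F)
    (h : AdaptedFrame D V p q r m a a' f) (hσ : StrictMonoOn σ (Set.Iic t))
    (hσr : ∀ k ≤ t, σ k ≤ r) :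
    ∃! W, IsLocalInclusion D V p q t m a a' σ σ 0 W := by
  refine ⟨Submodule.span K ((fun k => f (σ k)) '' Set.Iic t), ?_, fun W hW => ?_⟩
  · exact h.isLocalInclusion_span hres hσ hσ hσr (fun _ => le_rfl) rfl rfl
      (fun k hk => h.mem _ (hσr k hk))
      (fun k hk => by rw [sub_zero]; exact h.series.le_sections (h.mem _ (hσr k hk)))
      (fun k hk => h.ord_p _ (hσr k hk)) (fun k hk => h.ord_q _ (hσr k hk))
  · exact h.eq_span_of_isLocalInclusion hres hσ (fun k hk => h.ord_p _ (hσr k hk))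
      (fun k hk s hs _ hsp hsq => h.exists_eq_smul hs (hσr k hk) hsp hsq) hW

/-- On a curve whose marked points have nontorsion difference, a member of the adapted basis whose
vanishing orders at the marked points have sum `m - 1` has exactly one further zero, at which no
other member of the basis vanishes. -/
theorem exists_further_zero (hF : DegNonneg K F) (h : AdaptedFrame D V p q r m a a' f)
    (hpq' : NontorsionDifference p q) (ha : ∀ i ≤ r, a i ≤ a' i ∧ a' i ≤ a i + 1)
    {i : ℕ} (hi : i ≤ r) (hai : a' i = a i + 1) :
    ∃ z, z ≠ p ∧ z ≠ q ∧ f i ∈ (D - Finsupp.single z 1).sections ∧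
      (∀ l ≤ r, l ≠ i → f l ∉ z.ordGE (-(D z) + 1)) ∧
      ∀ B : CurveDivisor K F, (∀ P, 0 ≤ B P) → B p = 0 → B q = 0 → B.deg = 1 →
        f i ∈ (D - B).sections → B = Finsupp.single z 1 := by
  classical
  -- Removing the orders at `p` and `q` leaves a line bundle of degree a' i - a i = 1, hence a
  -- single zero `z`. It is neither `p` nor `q` because the orders there are exact.
  have hsec := mem_sections_sub_marked (D := D) (B := 0) h.p_ne_q rfl rfl
    (by rw [sub_zero]; exact h.series.le_sections (h.mem i hi))
    ((mem_ordGE_of_ord_eq (h.ord_p i hi)).2 le_rfl) ((mem_ordGE_of_ord_eq (h.ord_q i hi)).2 le_rfl)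
  obtain ⟨Z, hZ, hZdeg, hord⟩ := exists_zeros hF hsec (h.ne_zero i hi)
  rw [deg_sub_marked, deg_zero, h.deg_eq] at hZdeg
  obtain ⟨z, rfl⟩ := eq_single_of_deg_eq_one hZ (by omega)
  have hord' : ∀ P : Place K F, P ≠ p → P ≠ q →
      P.ord (f i) = (((Finsupp.single z 1 : CurveDivisor K F) P - D P : ℤ) : WithTop ℤ) := by
    intro P hPp hPq
    rw [hord]
    simp only [Finsupp.sub_apply, Finsupp.single_eq_of_ne hPp, Finsupp.single_eq_of_ne hPq,
      sub_zero]
  have hzp : z ≠ p := by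
    rintro rfl
    have h1 := hord z
    rw [h.ord_p i hi, WithTop.coe_eq_coe] at h1
    simp only [Finsupp.sub_apply, Finsupp.single_eq_same, Finsupp.single_eq_of_ne h.p_ne_q,
      Finsupp.zero_apply] at h1
    omega
  have hzq : z ≠ q := by
    rintro rfl
    have h1 := hord z
    rw [h.ord_q i hi, WithTop.coe_eq_coe] at h1
    simp only [Finsupp.sub_apply, Finsupp.single_eq_same, Finsupp.single_eq_of_ne h.p_ne_q.symm,
      Finsupp.zero_apply] at h1
    omega
  have hzz := hord' z hzp hzq
  rw [Finsupp.single_eq_same] at hzz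
  have hfi : f i ∈ (D - Finsupp.single z 1).sections :=
    mem_sections_sub_single (h.series.le_sections (h.mem i hi))
      ((mem_ordGE_of_ord_eq hzz).2 (by omega))
  have hzp' : (Finsupp.single z 1 : CurveDivisor K F) p = 0 := Finsupp.single_eq_of_ne hzp.symm
  have hzq' : (Finsupp.single z 1 : CurveDivisor K F) q = 0 := Finsupp.single_eq_of_ne hzq.symm
  refine ⟨z, hzp, hzq, hfi, fun l hl hli hfl => hli ?_, fun B hB hBp hBq hBdeg hfB => ?_⟩
  -- If `f l` vanished at `z` too, then `f l` and `f i` would both attain the degree bound with base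
  -- divisor `z`, and nontorsion would give l = i.
  · have hfl' := mem_sections_sub_single (h.series.le_sections (h.mem l hl)) hfl
    have hl1 := (mem_ordGE_of_ord_eq (h.ord_p l hl)).2 le_rfl
    have hl2 := (mem_ordGE_of_ord_eq (h.ord_q l hl)).2 le_rfl
    have hle := add_add_deg_le hF h.p_ne_q hzp' hzq' (h.ne_zero l hl) hfl' hl1 hl2
    rw [deg_single, h.deg_eq] at hle
    have := ha l hl
    have := hpq'.eq_of_deg_eq hF h.p_ne_q hzp' hzq' (h.ne_zero l hl) (h.ne_zero i hi) hfl' hfi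
      hl1 hl2 ((mem_ordGE_of_ord_eq (h.ord_p i hi)).2 le_rfl)
      ((mem_ordGE_of_ord_eq (h.ord_q i hi)).2 le_rfl)
      (by rw [deg_single, h.deg_eq]; omega) (by rw [deg_single, h.deg_eq]; omega)
    exact h.mono_left.injective (by omega)
  · obtain ⟨z', rfl⟩ := eq_single_of_deg_eq_one hB hBdeg
    have hz'p : z' ≠ p := by
      rintro rfl
      rw [Finsupp.single_eq_same] at hBp
      exact one_ne_zero hBp
    have hz'q : z' ≠ q := by
      rintro rfl
      rw [Finsupp.single_eq_same] at hBq
      exact one_ne_zero hBq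
    have h1 := mem_sections.1 hfB z'
    rw [mem_ordGE_of_ord_eq (hord' z' hz'p hz'q)] at h1
    simp only [Finsupp.sub_apply, Finsupp.single_eq_same, Finsupp.single_apply] at h1
    split_ifs at h1 with hzz'
    · rw [hzz']
    · omega

/-- A pencil spanned by two members of the adapted basis which do not vanish at `z` has exactly one
member vanishing at `z`. -/
theorem exists_pencil_member (hres : HasTrivialResidues K F)
    (h : AdaptedFrame D V p q r m a a' f) {z : Place K F} {i : ℕ}
    (hi : i + 1 ≤ r) (hz : f i ∉ z.ordGE (-(D z) + 1)) (hz' : f (i + 1) ∉ z.ordGE (-(D z) + 1)) :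
    ∃ g ∈ V, g ∈ (D - Finsupp.single z 1).sections ∧
      p.ord g = ((a i - D p : ℤ) : WithTop ℤ) ∧
      q.ord g = ((m - a' (i + 1) - D q : ℤ) : WithTop ℤ) ∧
      ∀ s ∈ V, s ∈ (D - Finsupp.single z 1).sections → s ∈ p.ordGE (a i - D p) →
        s ∈ q.ordGE (m - a' (i + 1) - D q) → ∃ c : K, s = c • g := by
  have hV : ∀ l ≤ r, f l ∈ V := h.mem
  have hsec : ∀ s ∈ V, s ∈ z.ordGE (-(D z)) := fun s hs =>
    mem_sections.1 (h.series.le_sections hs) z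
  have hord : z.ord (f (i + 1)) = ((-(D z) : ℤ) : WithTop ℤ) := by
    obtain ⟨k, hk⟩ := z.exists_ord_eq (h.ne_zero (i + 1) hi)
    have h1 := (mem_ordGE_of_ord_eq hk).1 (hsec _ (hV _ hi))
    rw [mem_ordGE_of_ord_eq hk] at hz'
    rw [hk]
    congr 1
    omega
  obtain ⟨b, hb⟩ := hres.exists_sub_smul_mem (hsec _ (hV i (by omega))) hord
  have hb0 : b ≠ 0 := by
    rintro rfl
    rw [zero_smul, sub_zero] at hb
    exact hz hb
  have hgV : f i - b • f (i + 1) ∈ V := sub_mem (hV _ (by omega)) (V.smul_mem _ (hV _ hi))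
  refine ⟨f i - b • f (i + 1), hgV, mem_sections_sub_single (h.series.le_sections hgV) hb, ?_, ?_,
    fun s hs hsz hsp hsq => ?_⟩
  · rw [← h.ord_p i (by omega)]
    refine AddValuation.map_sub_eq_of_lt_left p.ord ?_
    rw [p.ord_smul hb0, h.ord_p i (by omega), h.ord_p (i + 1) hi, WithTop.coe_lt_coe]
    have : a i < a (i + 1) := h.mono_left (Nat.lt_succ_self i)
    omega
  · rw [← h.ord_q (i + 1) hi, ← q.ord_smul hb0 (f (i + 1))]
    refine AddValuation.map_sub_eq_of_lt_right q.ord ?_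
    rw [q.ord_smul hb0, h.ord_q i (by omega), h.ord_q (i + 1) hi, WithTop.coe_lt_coe]
    have : a' i < a' (i + 1) := h.mono_right (Nat.lt_succ_self i)
    omega
  · obtain ⟨c, c', rfl⟩ := h.exists_eq_smul_add_smul hs hi hsp hsq
    refine ⟨c, ?_⟩
    have hsz' : c • f i + c' • f (i + 1) ∈ z.ordGE (-(D z) + 1) := by
      have := mem_sections.1 hsz z
      rw [Finsupp.sub_apply, Finsupp.single_eq_same] at this
      convert this using 2
      ring
    have hdiff : (c' + c * b) • f (i + 1) ∈ z.ordGE (-(D z) + 1) := by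
      have := sub_mem hsz' ((z.ordGE _).smul_mem c hb)
      convert this using 1
      rw [smul_sub, add_smul, mul_smul]
      abel
    have hc : c' + c * b = 0 := by
      by_contra hne
      have := (z.ordGE _).smul_mem (c' + c * b)⁻¹ hdiff
      rw [smul_smul, inv_mul_cancel₀ hne, one_smul] at this
      exact hz' this
    rw [eq_neg_of_add_eq_zero_left hc, smul_sub, neg_smul, mul_smul, sub_eq_add_neg]

/-- There is exactly one local inclusion with one base point, if one index stays and the others
increase by one. -/
theorem existsUnique_isLocalInclusion_one (hres : HasTrivialResidues K F) (hF : DegNonneg K F)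
    (h : AdaptedFrame D V p q r m a a' f) (hpq' : NontorsionDifference p q)
    (ha : ∀ i ≤ r, a i ≤ a' i ∧ a' i ≤ a i + 1) (hσ : StrictMonoOn σ (Set.Iic t))
    (hτ : StrictMonoOn τ (Set.Iic t)) (hτr : ∀ k ≤ t, τ k ≤ r) {e : ℕ} (he : e ≤ t)
    (hστ : τ e = σ e) (hστ' : ∀ k ≤ t, k ≠ e → τ k = σ k + 1) (hae : a' (σ e) = a (σ e) + 1) :
    ∃! BW : CurveDivisor K F × Submodule K F, BW.1.deg = 1 ∧
      IsLocalInclusion D V p q t m a a' σ τ BW.1 BW.2 := by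
  have her : σ e ≤ r := hστ ▸ hτr e he
  obtain ⟨z, hzp, hzq, hze, hz, hB⟩ := h.exists_further_zero hF hpq' ha her hae
  have hinjσ : ∀ k ≤ t, k ≠ e → σ k ≠ σ e := fun k hk hke h' =>
    hke (hσ.injOn (Set.mem_Iic.2 hk) (Set.mem_Iic.2 he) h')
  have hinjτ : ∀ k ≤ t, k ≠ e → τ k ≠ σ e := fun k hk hke h' =>
    hke (hτ.injOn (Set.mem_Iic.2 hk) (Set.mem_Iic.2 he) (h'.trans hστ.symm))
  have hex : ∀ k, ∃ g, k ≤ t → g ∈ V ∧ g ∈ (D - Finsupp.single z 1).sections ∧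
      p.ord g = ((a (σ k) - D p : ℤ) : WithTop ℤ) ∧
      q.ord g = ((m - a' (τ k) - D q : ℤ) : WithTop ℤ) ∧
      ∀ s ∈ V, s ∈ (D - Finsupp.single z 1).sections → s ∈ p.ordGE (a (σ k) - D p) →
        s ∈ q.ordGE (m - a' (τ k) - D q) → ∃ c : K, s = c • g := by
    intro k
    by_cases hk : k ≤ t
    · by_cases hke : k = e
      · subst hke
        rw [hστ]
        exact ⟨f (σ k), fun _ => ⟨h.mem _ her, hze, h.ord_p _ her, h.ord_q _ her,
          fun s hs _ hsp hsq => h.exists_eq_smul hs her hsp hsq⟩⟩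
      -- Here the index rises by one, so the section lies in the pencil of `f (σ k)` and `f (σ k +
      -- 1)`. Neither index is `σ e`, so neither member vanishes at `z`.
      · have hle := hτr k hk
        have hne := hinjτ k hk hke
        rw [hστ' k hk hke] at hle hne ⊢
        obtain ⟨g, hg⟩ := h.exists_pencil_member hres hle (hz _ (by omega) (hinjσ k hk hke))
          (hz _ hle hne)
        exact ⟨g, fun _ => hg⟩
    · exact ⟨0, fun h => absurd h hk⟩
  choose G hG using hex
  refine ⟨(Finsupp.single z 1, Submodule.span K (G '' Set.Iic t)), ⟨deg_single z 1, ?_⟩, ?_⟩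
  · refine h.isLocalInclusion_span hres hσ hτ hτr (fun P => ?_)
      (Finsupp.single_eq_of_ne hzp.symm) (Finsupp.single_eq_of_ne hzq.symm)
      (fun k hk => (hG k hk).1) (fun k hk => (hG k hk).2.1) (fun k hk => (hG k hk).2.2.1)
      (fun k hk => (hG k hk).2.2.2.1)
    classical
    rw [Finsupp.single_apply]
    split_ifs <;> omega
  · rintro ⟨B, W⟩ ⟨hBdeg, hW⟩
    simp only at hBdeg hW
    -- The stalled index forces a multiple of `f (σ e)` into `W`, so the base point has to be its
    -- only further zero `z`.
    obtain ⟨s, hsW, hs0, hsp, hsq⟩ := hW.series.exists_mem_of_vanishingSeq hres p q (i := e)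
      (j := t - e) (by omega)
    rw [hW.seq_p e he] at hsp
    rw [hW.seq_q e he, hστ] at hsq
    obtain ⟨c, rfl⟩ := h.exists_eq_smul (hW.le_ambient hsW) her hsp hsq
    have hc : c ≠ 0 := by
      rintro rfl
      exact hs0 (zero_smul _ _)
    have hfB := Submodule.smul_mem _ c⁻¹ (hW.vanish_on_base hsW)
    rw [smul_smul, inv_mul_cancel₀ hc, one_smul] at hfB
    obtain rfl := hB B hW.effective hW.base_p hW.base_q hBdeg hfB
    rw [h.eq_span_of_isLocalInclusion hres hσ (fun k hk => (hG k hk).2.2.1)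
      (fun k hk => (hG k hk).2.2.2.2) hW]

end AdaptedFrame

end LocalInclusion

/-! ### Combinatorics of the periodic word and of the indices. -/

section Combinatorics

/-- The `i`-th vanishing order at the first marked point behind `e` elliptic curves, for a limit
linear series of word type `(12⋯(2t+1))^u`. -/
def orderAt (t e i : ℕ) : ℕ :=
  -- A full period raises every order by 2t. Within the current period, the indices below the
  -- remainder have already had their letter and lag by one.
  2 * t * (e / (2 * t + 1)) +
    if i < e % (2 * t + 1) then i + e % (2 * t + 1) - 1 else i + e % (2 * t + 1)

theorem orderAt_strictMono (t e : ℕ) : StrictMono (orderAt t e) := by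
  refine strictMono_nat_of_lt_succ fun i => ?_
  unfold orderAt
  split_ifs <;> omega

theorem orderAt_zero (t i : ℕ) : orderAt t 0 i = i := by
  simp [orderAt]

theorem orderAt_mul (t u i : ℕ) : orderAt t ((2 * t + 1) * u) i = i + 2 * t * u := by
  simp [orderAt, add_comm]

theorem orderAt_succ (t e : ℕ) {i : ℕ} (hi : i ≤ 2 * t) :
    orderAt t (e + 1) i = orderAt t e i + if i = e % (2 * t + 1) then 0 else 1 := by
  have hlt := Nat.mod_lt e (by omega : 2 * t + 1 > 0)
  have hdm := Nat.div_add_mod e (2 * t + 1)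
  rcases Nat.lt_or_ge (e % (2 * t + 1)) (2 * t) with h | h
  · have h1 : (e + 1) / (2 * t + 1) = e / (2 * t + 1) := by
      rw [Nat.div_eq_iff (by omega : 0 < 2 * t + 1)]
      constructor
      · rw [mul_comm]
        omega
      · rw [mul_comm (e / (2 * t + 1))]
        omega
    have h2 : (e + 1) % (2 * t + 1) = e % (2 * t + 1) + 1 := by
      have := Nat.div_add_mod (e + 1) (2 * t + 1)
      rw [h1] at this
      omega
    unfold orderAt
    rw [h1, h2]
    split_ifs <;> omega
  · have h0 : e % (2 * t + 1) = 2 * t := by omega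
    have h2 : e + 1 = (2 * t + 1) * (e / (2 * t + 1) + 1) := by
      rw [mul_add]
      omega
    have h3 : orderAt t (e + 1) i = i + 2 * t * (e / (2 * t + 1) + 1) := by
      rw [← orderAt_mul, ← h2]
    rw [h3, mul_add]
    unfold orderAt
    rw [h0]
    split_ifs <;> omega

theorem sum_ite_le_card_Ico (t : ℕ) {σ : ℕ → ℕ} (hσ : Set.InjOn σ (Set.Iic t)) (x y : ℕ) :
    ∑ k ∈ Finset.range (t + 1), (if x ≤ σ k ∧ σ k < y then 1 else 0) ≤ y - x := by
  rw [← Finset.card_filter, ← Nat.card_Ico]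
  refine Finset.card_le_card_of_injOn σ (fun k hk => ?_) fun k hk l hl hkl => ?_
  · have := (Finset.mem_filter.1 hk).2
    exact Finset.mem_coe.2 (Finset.mem_Ico.2 this)
  · have h1 := Finset.mem_range.1 (Finset.mem_filter.1 hk).1
    have h2 := Finset.mem_range.1 (Finset.mem_filter.1 hl).1
    exact hσ (Set.mem_Iic.2 (by omega)) (Set.mem_Iic.2 (by omega)) hkl

/-- `d` base points on an elliptic component raise the indices by `t * d` in total, and by more if
there are at least two of them. -/
theorem sum_index_elliptic {t d e : ℕ} {σ τ : ℕ → ℕ} (hσ : Set.InjOn σ (Set.Iic t))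
    (hστ : ∀ k ≤ t, σ k ≤ τ k) (hτ : ∀ k ≤ t, τ k ≤ 2 * t)
    (h : ∀ k ≤ t, orderAt t e (σ k) + d ≤ orderAt t (e + 1) (τ k)) {k₀ : ℕ}
    (hk₀ : ∀ k ≤ t, k ≠ k₀ → orderAt t e (σ k) + d ≠ orderAt t (e + 1) (τ k)) :
    ∑ k ∈ Finset.range (t + 1), σ k + (t * d + if 2 ≤ d then 1 else 0) ≤
      ∑ k ∈ Finset.range (t + 1), τ k := by
  rcases Nat.eq_zero_or_pos d with rfl | hd
  · simpa using Finset.sum_le_sum fun k hk => hστ k (by rw [Finset.mem_range] at hk; omega)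
  set s := e % (2 * t + 1) with hs
  -- With d > 0, the inequality of orders amounts to σ + d ≤ τ + [σ < s] + [s < τ], and is strict
  -- for k ≠ k₀. Beyond the allowance for k₀, an index saves a step only by crossing `s` with s + 2
  -- - d ≤ σ < s. That interval holds at most d - 2 indices, none if d = 1.
  have key : ∀ k ∈ Finset.range (t + 1), σ k + d ≤ τ k +
      (if s + 2 - d ≤ σ k ∧ σ k < s then 1 else 0) + (if k = k₀ then 1 else 0) := by
    intro k hk
    have hk' : k ≤ t := by rw [Finset.mem_range] at hk; omega
    have h1 := hστ k hk'
    have h2 := h k hk'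
    have h3 := hk₀ k hk'
    rw [orderAt_succ t e (hτ k hk')] at h2 h3
    unfold orderAt at h2 h3
    rw [← hs] at h2 h3
    by_cases hkk : k = k₀
    · rw [if_pos hkk]
      clear h3
      split_ifs at h2 ⊢ <;> omega
    · replace h3 := h3 hkk
      rw [if_neg hkk]
      split_ifs at h2 h3 ⊢ <;> omega
  have hsum := Finset.sum_le_sum key
  simp only [Finset.sum_add_distrib, Finset.sum_const, Finset.card_range, smul_eq_mul,
    Finset.sum_ite_eq'] at hsum
  have hw := sum_ite_le_card_Ico t hσ (s + 2 - d) s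
  rw [add_mul, one_mul] at hsum
  split_ifs at hsum ⊢ <;> omega

/-- The ambient orders are the same at both ends, and the only saving comes from crossing the gap at
the remainder `s`: σ + d ≤ τ + [σ < s ≤ τ]. At most d - 1 indices can do so, which leaves a surplus
of at least 1 over td. -/
theorem sum_index_inserted {t d e : ℕ} {σ τ : ℕ → ℕ} (hσ : Set.InjOn σ (Set.Iic t))
    (hστ : ∀ k ≤ t, σ k ≤ τ k)
    (h : ∀ k ≤ t, orderAt t e (σ k) + d ≤ orderAt t e (τ k)) :
    ∑ k ∈ Finset.range (t + 1), σ k + (t * d + if 1 ≤ d then 1 else 0) ≤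
      ∑ k ∈ Finset.range (t + 1), τ k := by
  rcases Nat.eq_zero_or_pos d with rfl | hd
  · simpa using Finset.sum_le_sum fun k hk => hστ k (by rw [Finset.mem_range] at hk; omega)
  set s := e % (2 * t + 1) with hs
  have key : ∀ k ∈ Finset.range (t + 1), σ k + d ≤ τ k +
      (if s + 1 - d ≤ σ k ∧ σ k < s then 1 else 0) := by
    intro k hk
    have hk' : k ≤ t := by rw [Finset.mem_range] at hk; omega
    have h1 := hστ k hk'
    have h2 := h k hk'
    unfold orderAt at h2
    rw [← hs] at h2
    split_ifs at h2 ⊢ <;> omega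
  have hsum := Finset.sum_le_sum key
  simp only [Finset.sum_add_distrib, Finset.sum_const, Finset.card_range, smul_eq_mul] at hsum
  have hw := sum_ite_le_card_Ico t hσ (s + 1 - d) s
  rw [add_mul, one_mul] at hsum
  split_ifs <;> omega

theorem index_le_of_sum_eq_zero {t : ℕ} {σ τ : ℕ → ℕ} (hστ : ∀ k ≤ t, σ k ≤ τ k)
    (hsum : ∑ k ∈ Finset.range (t + 1), τ k = ∑ k ∈ Finset.range (t + 1), σ k) :
    ∀ k ≤ t, τ k = σ k := by
  intro k hk
  have := (Finset.sum_eq_sum_iff_of_le fun k hk => hστ k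
    (by rw [Finset.mem_range] at hk; omega)).1 hsum.symm k (Finset.mem_range.2 (by omega))
  exact this.symm

/-- Every index but `k₀` rises by at least 1, since a stalled index would attain equality in `h`. A
total rise of exactly t leaves no room for a rise by 2. -/
theorem index_le_of_sum_eq_one {t e : ℕ} {σ τ : ℕ → ℕ}
    (hστ : ∀ k ≤ t, σ k ≤ τ k) (hτ : ∀ k ≤ t, τ k ≤ 2 * t) {k₀ : ℕ}
    (h : ∀ k ≤ t, orderAt t e (σ k) + 1 ≤ orderAt t (e + 1) (τ k))
    (hk₀ : ∀ k ≤ t, k ≠ k₀ → orderAt t e (σ k) + 1 ≠ orderAt t (e + 1) (τ k))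
    (hsum : ∑ k ∈ Finset.range (t + 1), τ k = ∑ k ∈ Finset.range (t + 1), σ k + t) :
    ∀ k ≤ t, τ k ≤ σ k + 1 := by
  have key : ∀ k ∈ Finset.range (t + 1), σ k + 1 ≤ τ k + (if k = k₀ then 1 else 0) := by
    intro k hk
    have hk' : k ≤ t := by rw [Finset.mem_range] at hk; omega
    have h1 := hστ k hk'
    by_cases hkk : k = k₀
    · rw [if_pos hkk]
      omega
    · rw [if_neg hkk]
      by_contra hlt
      have h4 : τ k = σ k := by omega
      have h2 := h k hk'
      have h3 := hk₀ k hk' hkk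
      rw [orderAt_succ t e (hτ k hk'), h4] at h2 h3
      split_ifs at h2 h3 <;> omega
  intro k hk
  by_contra hlt
  have hslt := Finset.sum_lt_sum key ⟨k, Finset.mem_range.2 (by omega), by omega⟩
  simp only [Finset.sum_add_distrib, Finset.sum_const, Finset.card_range, smul_eq_mul,
    Finset.sum_ite_eq'] at hslt
  split_ifs at hslt <;> omega

/-- The indices behind `e` base points. -/
def shiftIndex (e k : ℕ) : ℕ := if k < e then k + e - 1 else k + e

theorem shiftIndex_strictMono (e : ℕ) : StrictMono (shiftIndex e) := by
  refine strictMono_nat_of_lt_succ fun k => ?_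
  unfold shiftIndex
  split_ifs <;> omega

theorem shiftIndex_succ_self (e : ℕ) : shiftIndex (e + 1) e = shiftIndex e e := by
  unfold shiftIndex
  split_ifs <;> omega

theorem shiftIndex_self (e : ℕ) : shiftIndex e e = 2 * e := by
  unfold shiftIndex
  split_ifs <;> omega

theorem shiftIndex_succ_of_ne {e k : ℕ} (h : k ≠ e) :
    shiftIndex (e + 1) k = shiftIndex e k + 1 := by
  unfold shiftIndex
  split_ifs <;> omega

theorem shiftIndex_le {t e k : ℕ} (he : e ≤ t + 1) (hk : k ≤ t) : shiftIndex e k ≤ 2 * t := by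
  unfold shiftIndex
  split_ifs <;> omega

/-- The defect k + e - σ k is 0 or 1, is weakly decreasing in `k` because σ is strictly increasing,
and has sum e. So it equals 1 precisely for the first e indices. -/
theorem eq_shiftIndex {t e : ℕ} {σ : ℕ → ℕ} (hσ : StrictMonoOn σ (Set.Iic t))
    (hle : ∀ k ≤ t, σ k ≤ k + e) (hge : ∀ k ≤ t, k + e ≤ σ k + 1)
    (hsum : ∑ k ∈ Finset.range (t + 1), σ k = ∑ k ∈ Finset.range (t + 1), k + t * e) :
    ∀ k ≤ t, σ k = shiftIndex e k := by
  have hmono : ∀ l ≤ t, ∀ k ≤ l, σ k + (l - k) ≤ σ l := by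
    intro l
    induction l with
    | zero =>
      intro _ k hk
      obtain rfl : k = 0 := by omega
      simp
    | succ l ih =>
      intro hl k hk
      rcases Nat.lt_or_ge k (l + 1) with h | h
      · have h1 := ih (by omega) k (by omega)
        have h2 := hσ (Set.mem_Iic.2 (by omega : l ≤ t)) (Set.mem_Iic.2 hl) (Nat.lt_succ_self l)
        omega
      · obtain rfl : k = l + 1 := by omega
        simp
  have hεsum : ∑ k ∈ Finset.range (t + 1), (k + e - σ k) = e := by
    have h1 : ∑ k ∈ Finset.range (t + 1), (k + e - σ k) + ∑ k ∈ Finset.range (t + 1), σ k =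
        ∑ k ∈ Finset.range (t + 1), (k + e) := by
      rw [← Finset.sum_add_distrib]
      refine Finset.sum_congr rfl fun k hk => ?_
      have := hle k (by rw [Finset.mem_range] at hk; omega)
      omega
    rw [hsum, Finset.sum_add_distrib, Finset.sum_const, Finset.card_range, smul_eq_mul, add_mul,
      one_mul] at h1
    omega
  intro k hk
  have h1 := hle k hk
  have h2 := hge k hk
  unfold shiftIndex
  split_ifs with hke
  · by_contra hne
    have hle' : ∑ l ∈ Finset.range (t + 1), (l + e - σ l) ≤
        ∑ l ∈ Finset.range (t + 1), (if l < k then 1 else 0) := by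
      refine Finset.sum_le_sum fun l hl => ?_
      have hl' : l ≤ t := by rw [Finset.mem_range] at hl; omega
      have h3 := hge l hl'
      split_ifs with hlk
      · omega
      · have := hmono l hl' k (by omega)
        omega
    rw [hεsum, ← Finset.card_filter] at hle'
    have hcard : (Finset.filter (fun l => l < k) (Finset.range (t + 1))).card ≤ k := by
      rw [← Finset.card_range k]
      refine Finset.card_le_card fun l hl => ?_
      rw [Finset.card_range]  at *
      exact Finset.mem_range.2 (Finset.mem_filter.1 hl).2
    omega
  · by_contra hne
    have hle' : ∑ l ∈ Finset.range (k + 1), 1 ≤ ∑ l ∈ Finset.range (k + 1), (l + e - σ l) := by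
      refine Finset.sum_le_sum fun l hl => ?_
      rw [Finset.mem_range] at hl
      have := hmono k hk l (by omega)
      omega
    have hle'' : ∑ l ∈ Finset.range (k + 1), (l + e - σ l) ≤
        ∑ l ∈ Finset.range (t + 1), (l + e - σ l) :=
      Finset.sum_le_sum_of_subset (Finset.range_subset_range.2 (by omega))
    rw [hεsum] at hle''
    rw [Finset.sum_const, Finset.card_range, smul_eq_mul, mul_one] at hle'
    omega

/-! ### Sums and inequalities along a chain. -/

variable {N : ℕ}

/-- Quantities which grow along a chain at least as much as prescribed, and in total at most as
much, grow exactly as prescribed. -/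
theorem chain_tight {S T L R : Fin N → ℕ} (h : ∀ c, S c + R c ≤ T c + L c)
    (hTS : ∀ c c' : Fin N, (c' : ℕ) = c + 1 → T c ≤ S c')
    (hRL : ∀ c c' : Fin N, (c' : ℕ) = c + 1 → R c = L c')
    (hfirst : ∀ c : Fin N, (c : ℕ) = 0 → L c ≤ S c)
    (hlast : ∀ c : Fin N, (c : ℕ) + 1 = N → T c ≤ R c) (c : Fin N) : S c = L c ∧ T c = R c := by
  have hlow : ∀ n : ℕ, ∀ c : Fin N, (c : ℕ) = n → L c ≤ S c := by
    intro n
    induction n with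
    | zero => exact hfirst
    | succ n ih =>
      intro c hc
      have h1 := ih ⟨n, by omega⟩ rfl
      have h2 := h ⟨n, by omega⟩
      have h3 := hTS ⟨n, by omega⟩ c hc
      have h4 := hRL ⟨n, by omega⟩ c hc
      omega
  have hup : ∀ n : ℕ, ∀ c : Fin N, (c : ℕ) + 1 + n = N → T c ≤ R c := by
    intro n
    induction n with
    | zero => exact hlast
    | succ n ih =>
      intro c hc
      have h1 := ih ⟨c + 1, by omega⟩ (by simp only; omega)
      have h2 := h ⟨c + 1, by omega⟩
      have h3 := hTS c ⟨c + 1, by omega⟩ rfl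
      have h4 := hRL c ⟨c + 1, by omega⟩ rfl
      omega
  have h1 := hlow c c rfl
  have h2 := hup (N - (c + 1)) c (by omega)
  have h3 := h c
  omega

/-- The sum of `d` over the members of the chain before `c`. -/
def sumBefore (d : Fin N → ℕ) (c : Fin N) : ℕ := ∑ x ∈ Finset.Iio c, d x

theorem sumBefore_succ (d : Fin N → ℕ) {c c' : Fin N} (h : (c' : ℕ) = c + 1) :
    sumBefore d c' = sumBefore d c + d c := by
  unfold sumBefore
  have : Finset.Iio c' = insert c (Finset.Iio c) := by
    ext x
    simp only [Finset.mem_Iio, Finset.mem_insert, Fin.lt_def, Fin.ext_iff]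
    omega
  rw [this, Finset.sum_insert (by simp), add_comm]

theorem sumBefore_zero (d : Fin N → ℕ) {c : Fin N} (h : (c : ℕ) = 0) : sumBefore d c = 0 := by
  unfold sumBefore
  refine Finset.sum_eq_zero fun x hx => ?_
  simp only [Finset.mem_Iio, Fin.lt_def] at hx
  omega

theorem sumBefore_last (d : Fin N → ℕ) {c : Fin N} (h : (c : ℕ) + 1 = N) :
    sumBefore d c + d c = ∑ x, d x := by
  unfold sumBefore
  have : (Finset.univ : Finset (Fin N)) = insert c (Finset.Iio c) := by
    ext x
    simp only [Finset.mem_univ, Finset.mem_Iio, Finset.mem_insert, Fin.lt_def, Fin.ext_iff,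
      true_iff]
    omega
  rw [this, Finset.sum_insert (by simp), add_comm]

theorem sumBefore_add_le (d : Fin N → ℕ) (c : Fin N) : sumBefore d c + d c ≤ ∑ x, d x := by
  unfold sumBefore
  rw [add_comm, ← Finset.sum_insert (by simp : c ∉ Finset.Iio c)]
  exact Finset.sum_le_sum_of_subset (Finset.subset_univ _)

open Classical in
/-- The indicator function of a subset of a chain. -/
noncomputable def indicatorRange {n : ℕ} (φ : Fin n ↪o Fin N) (c : Fin N) : ℕ :=
  if c ∈ Set.range φ then 1 else 0

theorem indicatorRange_apply {n : ℕ} (φ : Fin n ↪o Fin N) (k : Fin n) :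
    indicatorRange φ (φ k) = 1 := by
  simp [indicatorRange]

theorem indicatorRange_of_notMem {n : ℕ} {φ : Fin n ↪o Fin N} {c : Fin N}
    (hc : c ∉ Set.range φ) : indicatorRange φ c = 0 := by
  simp only [indicatorRange, if_neg hc]

theorem sum_indicatorRange {n : ℕ} (φ : Fin n ↪o Fin N) : ∑ c, indicatorRange φ c = n := by
  classical
  have h : (Finset.univ.filter fun c => c ∈ Set.range φ) = Finset.univ.map φ.toEmbedding := by
    ext c
    simp
  unfold indicatorRange
  rw [← Finset.card_filter]
  convert congrArg Finset.card h using 1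
  simp

theorem sumBefore_indicatorRange {n : ℕ} (φ : Fin n ↪o Fin N) (k : Fin n) :
    sumBefore (indicatorRange φ) (φ k) = k := by
  classical
  have h : ((Finset.Iio (φ k)).filter fun c => c ∈ Set.range φ) =
      (Finset.Iio k).map φ.toEmbedding := by
    ext c
    simp only [Finset.mem_filter, Finset.mem_Iio, Set.mem_range, Finset.mem_map]
    constructor
    · rintro ⟨hc, l, rfl⟩
      exact ⟨l, φ.lt_iff_lt.1 hc, rfl⟩
    · rintro ⟨l, hl, rfl⟩
      exact ⟨φ.lt_iff_lt.2 hl, l, rfl⟩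
  unfold sumBefore indicatorRange
  rw [← Finset.card_filter]
  convert congrArg Finset.card h using 1
  simp

end Combinatorics

/-! ### Index estimates for a subseries on one component. -/

section Local

variable {K : Type u} {F : Type v} [Field K] [Field F] [Algebra K F]
variable {D B : CurveDivisor K F} {V W : Submodule K F} {p q : Place K F}

/-- All vanishing orders are at least the multiplicity of the base divisor. -/
theorem IsLinearSeries.add_le_vanishingSeq (hres : HasTrivialResidues K F) {n : ℕ}
    (hW : IsLinearSeries D W n) (hWB : W ≤ (D - B).sections) (P : Place K F) {k : ℕ} (hk : k < n) :
    B P + k ≤ vanishingSeq D W P k := by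
  induction k with
  | zero =>
    obtain ⟨f, hf, hf0, hfP⟩ := hW.hasVanishingOrder_vanishingSeq hres P hk
    have := (mem_ordGE_of_ord_eq hfP).1 (mem_sections.1 (hWB hf) P)
    rw [Finsupp.sub_apply] at this
    omega
  | succ k ih =>
    have h1 := ih (by omega)
    have h2 := hW.vanishingSeq_strictMonoOn hres P (Set.mem_Iio.2 (by omega : k < n))
      (Set.mem_Iio.2 hk) (Nat.lt_succ_self k)
    push_cast
    omega

theorem IsLinearSeries.le_vanishingSeq (hres : HasTrivialResidues K F) {n : ℕ}
    (hW : IsLinearSeries D W n) (P : Place K F) {k : ℕ} (hk : k < n) :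
    k ≤ vanishingSeq D W P k := by
  have := hW.add_le_vanishingSeq (B := 0) hres (by rw [sub_zero]; exact hW.le_sections) P hk
  rw [Finsupp.zero_apply] at this
  omega

theorem IsLinearSeries.vanishingSeq_add_le (hres : HasTrivialResidues K F) (hF : DegNonneg K F)
    (hpq : p ≠ q) {r m : ℕ} (hD : D.deg = m) (hV : IsLinearSeries D V (r + 1)) {i : ℕ}
    (hi : i ≤ r) : vanishingSeq D V p i + vanishingSeq D V q (r - i) ≤ m := by
  obtain ⟨f, -, -, x, y, hx, hy, hxy, -⟩ := exists_mem_ord_eq hres hF hpq hD hV hi rfl rfl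
  omega

/-- Two aligned indices would give two sections without zeros away from `p` and `q`, hence equal
orders at `p`. -/
theorem IsLinearSeries.vanishingSeq_add_lt (hres : HasTrivialResidues K F) (hF : DegNonneg K F)
    (hpq : p ≠ q) (hpq' : NontorsionDifference p q) {r m : ℕ} (hD : D.deg = m)
    (hV : IsLinearSeries D V (r + 1)) {i w : ℕ} (hi : i ≤ r) (hw : w ≤ r) (hiw : i ≠ w)
    (haw : vanishingSeq D V p w + vanishingSeq D V q (r - w) = m) :
    vanishingSeq D V p i + vanishingSeq D V q (r - i) < m := by
  refine lt_of_le_of_ne (hV.vanishingSeq_add_le hres hF hpq hD hi) fun hai => hiw ?_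
  obtain ⟨f, hf, hf0, hfp, hfq⟩ := hV.exists_mem_of_vanishingSeq hres p q (i := i) (j := r - i)
    (by omega)
  obtain ⟨f', hf', hf0', hfp', hfq'⟩ := hV.exists_mem_of_vanishingSeq hres p q (i := w)
    (j := r - w) (by omega)
  have hsec : V ≤ (D - 0).sections := by
    rw [sub_zero]
    exact hV.le_sections
  have := hpq'.eq_of_deg_eq (B := 0) hF hpq rfl rfl hf0 hf0' (hsec hf) (hsec hf') hfp hfq hfp' hfq'
    (by rw [deg_zero]; omega) (by rw [deg_zero]; omega)
  exact (hV.vanishingSeq_strictMonoOn hres p).injOn (Set.mem_Iio.2 (by omega))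
    (Set.mem_Iio.2 (by omega)) (by omega)

variable {t m e d : ℕ}

theorem AdaptedFrame.sum_index_elliptic {f : ℕ → F} {σ τ : ℕ → ℕ}
    (hres : HasTrivialResidues K F) (hF : DegNonneg K F)
    (h : AdaptedFrame D V p q (2 * t) m (orderAt t e) (orderAt t (e + 1)) f)
    (hpq' : NontorsionDifference p q) (hW : IsLinearSeries D W (t + 1))
    (hWB : W ≤ (D - B).sections) (hBp : B p = 0) (hBq : B q = 0) (hBd : B.deg = d)
    (hσ : StrictMonoOn σ (Set.Iic t))
    (hστ : ∀ k ≤ t, σ k ≤ τ k ∧ τ k ≤ 2 * t ∧ vanishingSeq D W p k = orderAt t e (σ k) ∧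
      (vanishingSeq D W q (t - k) : ℤ) = m - orderAt t (e + 1) (τ k)) :
    ∑ k ∈ Finset.range (t + 1), σ k + (t * d + if 2 ≤ d then 1 else 0) ≤
      ∑ k ∈ Finset.range (t + 1), τ k ∧
    (d = 1 → ∑ k ∈ Finset.range (t + 1), τ k = ∑ k ∈ Finset.range (t + 1), σ k + t →
      ∀ k ≤ t, τ k ≤ σ k + 1) := by
  have hle : ∀ k ≤ t, orderAt t e (σ k) + d ≤ orderAt t (e + 1) (τ k) := by
    intro k hk
    have := h.index_add_deg_le hres hF hW hWB hBp hBq hk (hστ k hk).2.2.1 (hστ k hk).2.2.2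
    omega
  -- The index `k₀` is the only one attaining equality; if there is none, any value will do.
  obtain ⟨k₀, hk₀⟩ : ∃ k₀, ∀ k ≤ t, k ≠ k₀ →
      orderAt t e (σ k) + d ≠ orderAt t (e + 1) (τ k) := by
    by_cases hex : ∃ k₀ ≤ t, orderAt t e (σ k₀) + d = orderAt t (e + 1) (τ k₀)
    · obtain ⟨k₀, hk₀, heq⟩ := hex
      refine ⟨k₀, fun k hk hne heq' => hne ?_⟩
      have := h.index_eq_of_add_deg_eq hres hF hpq' hW hWB hBp hBq hk (hστ k hk).2.2.1
        (hστ k hk).2.2.2 hk₀ (hστ k₀ hk₀).2.2.1 (hστ k₀ hk₀).2.2.2 (by omega) (by omega)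
      exact hσ.injOn (Set.mem_Iic.2 hk) (Set.mem_Iic.2 hk₀) this
    · exact ⟨0, fun k hk _ heq => hex ⟨k, hk, heq⟩⟩
  refine ⟨_root_.sum_index_elliptic hσ.injOn (fun k hk => (hστ k hk).1)
    (fun k hk => (hστ k hk).2.1) hle hk₀, fun hd hsum => ?_⟩
  subst hd
  exact index_le_of_sum_eq_one (fun k hk => (hστ k hk).1) (fun k hk => (hστ k hk).2.1) hle hk₀ hsum

theorem AdaptedFrame.sum_index_inserted {f : ℕ → F} {σ τ : ℕ → ℕ}
    (hres : HasTrivialResidues K F) (hF : DegNonneg K F)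
    (h : AdaptedFrame D V p q (2 * t) m (orderAt t e) (orderAt t e) f)
    (hW : IsLinearSeries D W (t + 1))
    (hWB : W ≤ (D - B).sections) (hBp : B p = 0) (hBq : B q = 0) (hBd : B.deg = d)
    (hσ : StrictMonoOn σ (Set.Iic t))
    (hστ : ∀ k ≤ t, σ k ≤ τ k ∧ τ k ≤ 2 * t ∧ vanishingSeq D W p k = orderAt t e (σ k) ∧
      (vanishingSeq D W q (t - k) : ℤ) = m - orderAt t e (τ k)) :
    ∑ k ∈ Finset.range (t + 1), σ k + (t * d + if 1 ≤ d then 1 else 0) ≤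
      ∑ k ∈ Finset.range (t + 1), τ k := by
  refine _root_.sum_index_inserted (e := e) hσ.injOn (fun k hk => (hστ k hk).1) fun k hk => ?_
  have := h.index_add_deg_le hres hF hW hWB hBp hBq hk (hστ k hk).2.2.1 (hστ k hk).2.2.2
  omega

/-- The part of a divisor away from the marked points. -/
noncomputable def CurveDivisor.awayFrom (B : CurveDivisor K F) (p q : Place K F) :
    CurveDivisor K F :=
  B - Finsupp.single p (B p) - Finsupp.single q (B q)

theorem CurveDivisor.awayFrom_left (hpq : p ≠ q) : B.awayFrom p q p = 0 := by
  simp only [awayFrom, Finsupp.sub_apply, Finsupp.single_eq_same, Finsupp.single_eq_of_ne hpq]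
  omega

theorem CurveDivisor.awayFrom_right (hpq : p ≠ q) : B.awayFrom p q q = 0 := by
  simp only [awayFrom, Finsupp.sub_apply, Finsupp.single_eq_same,
    Finsupp.single_eq_of_ne hpq.symm]
  omega

theorem CurveDivisor.awayFrom_of_ne {P : Place K F} (hp : P ≠ p) (hq : P ≠ q) :
    B.awayFrom p q P = B P := by
  simp only [awayFrom, Finsupp.sub_apply, Finsupp.single_eq_of_ne hp, Finsupp.single_eq_of_ne hq]
  omega

theorem CurveDivisor.awayFrom_effective (hpq : p ≠ q) (hB : ∀ P, 0 ≤ B P) (P : Place K F) :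
    0 ≤ B.awayFrom p q P ∧ B.awayFrom p q P ≤ B P := by
  by_cases hp : P = p
  · subst hp
    rw [awayFrom_left hpq]
    exact ⟨le_rfl, hB _⟩
  by_cases hq : P = q
  · subst hq
    rw [awayFrom_right hpq]
    exact ⟨le_rfl, hB _⟩
  rw [awayFrom_of_ne hp hq]
  exact ⟨hB P, le_rfl⟩

theorem CurveDivisor.deg_awayFrom : (B.awayFrom p q).deg = B.deg - B p - B q := by
  rw [awayFrom, deg_sub, deg_sub, deg_single, deg_single]

end Local

/-- Quantities which grow along a chain at most as much as prescribed, starting below the prescribed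
value and ending at least one below it, stay within this distance of the prescribed values. -/
theorem chain_bounds {N : ℕ} {S T L R : Fin N → ℕ} (h : ∀ c, T c + L c ≤ S c + R c)
    (hTS : ∀ c c' : Fin N, (c' : ℕ) = c + 1 → S c' = T c)
    (hRL : ∀ c c' : Fin N, (c' : ℕ) = c + 1 → R c = L c')
    (hfirst : ∀ c : Fin N, (c : ℕ) = 0 → S c ≤ L c)
    (hlast : ∀ c : Fin N, (c : ℕ) + 1 = N → R c ≤ T c + 1) (c : Fin N) :
    S c ≤ L c ∧ T c ≤ R c ∧ L c ≤ S c + 1 ∧ R c ≤ T c + 1 := by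
  have hlow : ∀ n : ℕ, ∀ c : Fin N, (c : ℕ) = n → S c ≤ L c := by
    intro n
    induction n with
    | zero => exact hfirst
    | succ n ih =>
      intro c hc
      have h1 := ih ⟨n, by omega⟩ rfl
      have h2 := h ⟨n, by omega⟩
      have h3 := hTS ⟨n, by omega⟩ c hc
      have h4 := hRL ⟨n, by omega⟩ c hc
      omega
  have hup : ∀ n : ℕ, ∀ c : Fin N, (c : ℕ) + 1 + n = N → R c ≤ T c + 1 := by
    intro n
    induction n with
    | zero => exact hlast
    | succ n ih =>
      intro c hc
      have h1 := ih ⟨c + 1, by omega⟩ (by simp only; omega)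
      have h2 := h ⟨c + 1, by omega⟩
      have h3 := hTS c ⟨c + 1, by omega⟩ rfl
      have h4 := hRL c ⟨c + 1, by omega⟩ rfl
      omega
  have h1 := hlow c c rfl
  have h2 := hup (N - (c + 1)) c (by omega)
  have h3 := h c
  omega

/-! ### The ambient series on the chain. -/

namespace EllipticChain

variable {K : Type u} [Field K] {g N : ℕ} {X : EllipticChain.{u, v} K g N}

theorem degNonneg [IsAlgClosed K] (X : EllipticChain.{u, v} K g N) (c : Fin N) :
    DegNonneg K (X.F c) := by
  intro D f hf hf0
  have hres := hasTrivialResidues (X.isCurve c)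
  by_cases hc : c ∈ Set.range X.elliptic
  · obtain ⟨j, rfl⟩ := hc
    exact deg_nonneg_of_mem_sections hres (X.genus_elliptic j) (X.p _) hf hf0
  · exact deg_nonneg_of_mem_sections hres (X.genus_inserted c hc) (X.p _) hf hf0

/-- The number of elliptic components before the component `c`. -/
noncomputable def numBefore (X : EllipticChain.{u, v} K g N) (c : Fin N) : ℕ :=
  sumBefore (indicatorRange X.elliptic) c

theorem IsLimitLinearSeries.isLinearSeries {r m : ℕ} {D : ∀ c, CurveDivisor K (X.F c)}
    {V : ∀ c, Submodule K (X.F c)} (hV : X.IsLimitLinearSeries r m D V) (c : Fin N) :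
    IsLinearSeries (D c) (V c) (r + 1) :=
  ⟨hV.le_sections c, Module.finite_of_finrank_pos (by rw [hV.finrank_eq]; omega), hV.finrank_eq c⟩

end EllipticChain

namespace EllipticChain

variable {K : Type u} [Field K] {t u' N : ℕ} {X : EllipticChain.{u, v} K ((2 * t + 1) * u') N}
  {D : ∀ c, CurveDivisor K (X.F c)} {V : ∀ c, Submodule K (X.F c)}

theorem periodicWord_val (j : Fin ((2 * t + 1) * u')) :
    (periodicWord t u' j : ℕ) = j % (2 * t + 1) := rfl

/-- The vanishing sequences of a limit linear series are determined by its word type if the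
Brill-Noether number is zero. -/
theorem vanishingSeq_eq_orderAt [IsAlgClosed K]
    (hV : X.IsLimitLinearSeries (2 * t) (2 * t * (u' + 1)) D V)
    (hw : X.HasWordType (2 * t) (2 * t * (u' + 1)) D V (periodicWord t u')) {i : ℕ}
    (hi : i ≤ 2 * t) (c : Fin N) :
    vanishingSeq (D c) (V c) (X.p c) i = orderAt t (X.numBefore c) i ∧
      (vanishingSeq (D c) (V c) (X.q c) (2 * t - i) : ℤ) = (2 * t * (u' + 1) : ℕ) -
        orderAt t (X.numBefore c + indicatorRange X.elliptic c) i := by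
  have hres := fun c => hasTrivialResidues (X.isCurve c)
  have hle : ∀ c, vanishingSeq (D c) (V c) (X.p c) i + vanishingSeq (D c) (V c) (X.q c) (2 * t - i)
      ≤ 2 * t * (u' + 1) := fun c => (hV.isLinearSeries c).vanishingSeq_add_le (hres c)
        (X.degNonneg c) (X.p_ne_q c) (hV.degree c) hi
  -- The word and nontorsion bound the growth of the i-th order from below on each component. It
  -- starts at i or above and ends at i + 2tu or below, so the bounds are equalities throughout.
  have key := chain_tight (S := fun c => vanishingSeq (D c) (V c) (X.p c) i)
    (T := fun c => 2 * t * (u' + 1) - vanishingSeq (D c) (V c) (X.q c) (2 * t - i))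
    (L := fun c => orderAt t (X.numBefore c) i)
    (R := fun c => orderAt t (X.numBefore c + indicatorRange X.elliptic c) i)
    ?_ ?_ ?_ ?_ ?_ c
  · have := hle c
    omega
  · intro c
    have hlec := hle c
    by_cases hc : c ∈ Set.range X.elliptic
    · obtain ⟨j, rfl⟩ := hc
      rw [indicatorRange_apply, orderAt_succ t _ hi, numBefore, sumBefore_indicatorRange]
      split_ifs with hij
      · omega
      · have hwj := hw j
        rw [periodicWord_val] at hwj
        have := (hV.isLinearSeries _).vanishingSeq_add_lt (hres _) (X.degNonneg _) (X.p_ne_q _)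
          (X.nontorsion j) (hV.degree _) hi
          (Nat.le_of_lt_succ (Nat.mod_lt (j : ℕ) (by omega : 2 * t + 1 > 0))) hij hwj
        omega
    · rw [indicatorRange_of_notMem hc, add_zero]
      omega
  · intro c c' hcc'
    have := hV.compatible c c' hcc' (2 * t - i) (by omega)
    rw [show 2 * t - (2 * t - i) = i by omega] at this
    omega
  · intro c c' hcc'
    simp only [numBefore, sumBefore_succ _ hcc']
  · intro c hc
    simp only [numBefore, sumBefore_zero _ hc, orderAt_zero]
    exact (hV.isLinearSeries c).le_vanishingSeq (hres c) _ (by omega)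
  · intro c hc
    simp only [numBefore, sumBefore_last _ hc, sum_indicatorRange, orderAt_mul]
    have := (hV.isLinearSeries c).le_vanishingSeq (hres c) (X.q c) (k := 2 * t - i) (by omega)
    rw [mul_add, mul_one]
    omega

theorem exists_adaptedFrame [IsAlgClosed K]
    (hV : X.IsLimitLinearSeries (2 * t) (2 * t * (u' + 1)) D V)
    (hw : X.HasWordType (2 * t) (2 * t * (u' + 1)) D V (periodicWord t u')) (c : Fin N) :
    ∃ f, AdaptedFrame (D c) (V c) (X.p c) (X.q c) (2 * t) (2 * t * (u' + 1))
      (orderAt t (X.numBefore c)) (orderAt t (X.numBefore c + indicatorRange X.elliptic c)) f := by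
  have hres := fun c => hasTrivialResidues (X.isCurve c)
  have hp := fun i (hi : i ≤ 2 * t) => (vanishingSeq_eq_orderAt hV hw hi c).1
  have hq := fun i (hi : i ≤ 2 * t) => (vanishingSeq_eq_orderAt hV hw hi c).2
  by_cases hc : c ∈ Set.range X.elliptic
  · obtain ⟨j, rfl⟩ := hc
    rw [indicatorRange_apply] at hq ⊢
    refine exists_adaptedFrame_of_nontorsion (hres _) (X.degNonneg _) (X.p_ne_q _)
      (X.nontorsion j) (hV.degree _) (hV.isLinearSeries _) (orderAt_strictMono _ _)
      (orderAt_strictMono _ _) hp hq (w := X.numBefore (X.elliptic j) % (2 * t + 1))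
      (Nat.le_of_lt_succ (Nat.mod_lt _ (by omega : 2 * t + 1 > 0))) ?_ ?_
    · rw [orderAt_succ t _ (Nat.le_of_lt_succ (Nat.mod_lt _ (by omega : 2 * t + 1 > 0))),
        if_pos rfl, add_zero]
    · intro i hi hiw
      rw [orderAt_succ t _ hi, if_neg hiw]
  · rw [indicatorRange_of_notMem hc, add_zero] at hq ⊢
    exact exists_adaptedFrame_of_eq (hres _) (X.degNonneg _) (X.p_ne_q _)
      (hV.degree _) (hV.isLinearSeries _) (orderAt_strictMono _ _) hp hq

end EllipticChain

/-! ### Global inclusions and distributions of base points. -/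

namespace EllipticChain

variable {K : Type u} [Field K] {t u' N : ℕ} {X : EllipticChain.{u, v} K ((2 * t + 1) * u') N}
  {D : ∀ c, CurveDivisor K (X.F c)} {V : ∀ c, Submodule K (X.F c)}

/-- All components of an inclusion are local inclusions whose base divisors have degrees `d` and
whose indices are `σ` and `τ`. -/
structure Inclusion.HasIndices (I : X.Inclusion t (t + 1) (2 * t * (u' + 1)) D V)
    (d : Fin N → ℕ) (σ τ : Fin N → ℕ → ℕ) : Prop where
  deg_eq : ∀ c, (I.base c).deg = d c
  base_p : ∀ c, I.base c (X.p c) = 0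
  base_q : ∀ c, I.base c (X.q c) = 0
  le_one : ∀ c, d c ≤ 1
  elliptic : ∀ c, d c = 1 → c ∈ Set.range X.elliptic
  mono_left : ∀ c, StrictMonoOn (σ c) (Set.Iic t)
  mono_right : ∀ c, StrictMonoOn (τ c) (Set.Iic t)
  le : ∀ c, ∀ k ≤ t, σ c k ≤ τ c k ∧ τ c k ≤ σ c k + d c
  right_le : ∀ c, ∀ k ≤ t, τ c k ≤ 2 * t
  seq_p : ∀ c, ∀ k ≤ t,
    vanishingSeq (D c) (I.W c) (X.p c) k = orderAt t (X.numBefore c) (σ c k)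
  seq_q : ∀ c, ∀ k ≤ t, (vanishingSeq (D c) (I.W c) (X.q c) (t - k) : ℤ) =
    (2 * t * (u' + 1) : ℕ) - orderAt t (X.numBefore c + indicatorRange X.elliptic c) (τ c k)
  sum_left : ∀ c, ∑ k ∈ Finset.range (t + 1), σ c k =
    ∑ k ∈ Finset.range (t + 1), k + t * sumBefore d c
  sum_right : ∀ c, ∑ k ∈ Finset.range (t + 1), τ c k =
    ∑ k ∈ Finset.range (t + 1), k + t * (sumBefore d c + d c)
  next : ∀ c c' : Fin N, (c' : ℕ) = c + 1 → ∀ k ≤ t, τ c k ≤ σ c' k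
  first : ∀ c : Fin N, (c : ℕ) = 0 → ∀ k ≤ t, k ≤ σ c k
  last : ∀ c : Fin N, (c : ℕ) + 1 = N → ∀ k ≤ t, τ c k ≤ k + t

theorem Inclusion.sum_deg {r₂ δ m : ℕ} (I : X.Inclusion r₂ δ m D V) {d : Fin N → ℕ}
    (hd : ∀ c, (I.base c).deg = d c) : ∑ c, d c = δ := by
  have := I.base_degree
  simp only [hd] at this
  exact_mod_cast this

theorem Inclusion.vanish_le_sections {r₂ δ m : ℕ} (I : X.Inclusion r₂ δ m D V)
    (c : Fin N) {B : CurveDivisor K (X.F c)} (hB : ∀ P, B P ≤ I.base c P) :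
    I.W c ≤ (D c - B).sections := by
  refine (I.vanish_on_base c).trans (sections_mono fun P => ?_)
  rw [Finsupp.sub_apply, Finsupp.sub_apply]
  have := hB P
  omega

open Classical in
/-- Base points on a component which raise the sum of the indices by more than `t` each. -/
noncomputable def excess (X : EllipticChain.{u, v} K ((2 * t + 1) * u') N) (d : Fin N → ℕ)
    (c : Fin N) : ℕ :=
  if c ∈ Set.range X.elliptic then if 2 ≤ d c then 1 else 0 else if 1 ≤ d c then 1 else 0

/-- This is the global count: the sum of the indices can rise by at most t(t + 1) along the chain,
which t + 1 base points use up only if each costs exactly t. -/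
theorem Inclusion.exists_hasIndices [IsAlgClosed K]
    (hV : X.IsLimitLinearSeries (2 * t) (2 * t * (u' + 1)) D V)
    (hw : X.HasWordType (2 * t) (2 * t * (u' + 1)) D V (periodicWord t u'))
    (I : X.Inclusion t (t + 1) (2 * t * (u' + 1)) D V) :
    ∃ d σ τ, I.HasIndices d σ τ := by
  have hres := fun c => hasTrivialResidues (X.isCurve c)
  have hW := fun c => I.isLimitLinearSeries.isLinearSeries c
  choose f hf using exists_adaptedFrame hV hw
  choose σ τ hσ hτ hστ using fun c => (hf c).exists_indices (hres c) (hW c) (I.le_ambient c)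
  -- Base points may also sit at the two free ends of the chain. They are counted separately as `zp`
  -- and `zq`, since the local estimates concern base points away from `p` and `q`.
  set B : ∀ c, CurveDivisor K (X.F c) := fun c => (I.base c).awayFrom (X.p c) (X.q c) with hB
  have hBeff := fun c => awayFrom_effective (X.p_ne_q c) (I.base_effective c)
  have hWB : ∀ c, I.W c ≤ (D c - B c).sections :=
    fun c => I.vanish_le_sections c fun P => (hBeff c P).2
  obtain ⟨d, hd⟩ : ∃ d : Fin N → ℕ, ∀ c, (B c).deg = d c :=
    ⟨fun c => (B c).deg.toNat, fun c =>
      (Int.toNat_of_nonneg (deg_nonneg fun P => (hBeff c P).1)).symm⟩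
  obtain ⟨zp, hzp⟩ : ∃ z : Fin N → ℕ, ∀ c, I.base c (X.p c) = z c :=
    ⟨fun c => (I.base c (X.p c)).toNat, fun c =>
      (Int.toNat_of_nonneg (I.base_effective c _)).symm⟩
  obtain ⟨zq, hzq⟩ : ∃ z : Fin N → ℕ, ∀ c, I.base c (X.q c) = z c :=
    ⟨fun c => (I.base c (X.q c)).toNat, fun c =>
      (Int.toNat_of_nonneg (I.base_effective c _)).symm⟩
  have hdeg : ∀ c, (I.base c).deg = ((d c + zp c + zq c : ℕ) : ℤ) := by
    intro c
    have h1 := hd c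
    rw [hB] at h1
    simp only [deg_awayFrom, hzp, hzq] at h1
    push_cast
    omega
  have htotal : ∑ c, d c + ∑ c, zp c + ∑ c, zq c = t + 1 := by
    rw [← Finset.sum_add_distrib, ← Finset.sum_add_distrib]
    exact I.sum_deg hdeg
  have hzp0 : ∀ c : Fin N, (c : ℕ) = 0 → zp c = ∑ x, zp x := by
    intro c hc
    refine (Finset.sum_eq_single c (fun x _ hx => ?_) (by simp)).symm
    have h0 : 0 < (x : ℕ) := by
      have := Fin.val_ne_of_ne hx
      omega
    have := hzp x
    rw [I.base_p x h0] at this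
    omega
  have hzq0 : ∀ c : Fin N, (c : ℕ) + 1 = N → zq c = ∑ x, zq x := by
    intro c hc
    refine (Finset.sum_eq_single c (fun x _ hx => ?_) (by simp)).symm
    have h0 : (x : ℕ) + 1 < N := by
      have := Fin.val_ne_of_ne hx
      omega
    have := hzq x
    rw [I.base_q x h0] at this
    omega
  have hgrow : ∀ c, ∑ k ∈ Finset.range (t + 1), σ c k + (t * d c + X.excess d c) ≤
        ∑ k ∈ Finset.range (t + 1), τ c k ∧
      (c ∈ Set.range X.elliptic → d c = 1 → ∑ k ∈ Finset.range (t + 1), τ c k =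
        ∑ k ∈ Finset.range (t + 1), σ c k + t → ∀ k ≤ t, τ c k ≤ σ c k + 1) := by
    intro c
    have hfc := hf c
    have hστc := hστ c
    by_cases hc : c ∈ Set.range X.elliptic
    · obtain ⟨j, rfl⟩ := hc
      rw [indicatorRange_apply] at hfc hστc
      have := hfc.sum_index_elliptic (hres _) (X.degNonneg _) (X.nontorsion j) (hW _)
        (hWB _) (awayFrom_left (X.p_ne_q _)) (awayFrom_right (X.p_ne_q _)) (hd _) (hσ _) hστc
      rw [excess, if_pos (Set.mem_range_self j)]
      exact ⟨this.1, fun _ => this.2⟩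
    · rw [indicatorRange_of_notMem hc, add_zero] at hfc hστc
      have := hfc.sum_index_inserted (hres _) (X.degNonneg _) (hW _)
        (hWB _) (awayFrom_left (X.p_ne_q _)) (awayFrom_right (X.p_ne_q _)) (hd _) (hσ _) hστc
      rw [excess, if_neg hc]
      exact ⟨this, fun h => absurd h hc⟩
  have hnext : ∀ c c' : Fin N, (c' : ℕ) = c + 1 → ∀ k ≤ t, τ c k ≤ σ c' k := by
    intro c c' hcc' k hk
    have h1 := I.isLimitLinearSeries.compatible c c' hcc' (t - k) (by omega)
    rw [show t - (t - k) = k by omega] at h1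
    have h2 := (hστ c k hk).2.2.2
    have h3 := (hστ c' k hk).2.2.1
    have h4 : X.numBefore c' = X.numBefore c + indicatorRange X.elliptic c :=
      sumBefore_succ _ hcc'
    rw [h4] at h3
    exact (orderAt_strictMono t (X.numBefore c + indicatorRange X.elliptic c)).le_iff_le.1
      (by omega)
  have hfirst : ∀ c : Fin N, (c : ℕ) = 0 → ∀ k ≤ t, ∑ x, zp x + k ≤ σ c k := by
    intro c hc k hk
    have h1 := (hW c).add_le_vanishingSeq (hres c) (I.vanish_on_base c) (X.p c) (k := k) (by omega)
    rw [(hστ c k hk).2.2.1, hzp, hzp0 c hc, numBefore, sumBefore_zero _ hc, orderAt_zero] at h1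
    omega
  have hlast : ∀ c : Fin N, (c : ℕ) + 1 = N → ∀ k ≤ t, τ c k + ∑ x, zq x ≤ k + t := by
    intro c hc k hk
    have h1 := (hW c).add_le_vanishingSeq (hres c) (I.vanish_on_base c) (X.q c) (k := t - k)
      (by omega)
    rw [(hστ c k hk).2.2.2, hzq, hzq0 c hc, numBefore, sumBefore_last _ hc, sum_indicatorRange,
      orderAt_mul, mul_add, mul_one] at h1
    omega
  set κ : Fin N → ℕ := fun c => t * d c + X.excess d c with hκ
  have hκsum : ∑ c, κ c = t * ∑ c, d c + ∑ c, X.excess d c := by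
    rw [hκ, Finset.sum_add_distrib, Finset.mul_sum]
  have hfirstsum : ∀ c : Fin N, (c : ℕ) = 0 → ∑ k ∈ Finset.range (t + 1), k +
      (t + 1) * ∑ x, zp x ≤ ∑ k ∈ Finset.range (t + 1), σ c k := by
    intro c hc
    have := Finset.sum_le_sum fun k (hk : k ∈ Finset.range (t + 1)) =>
      hfirst c hc k (by rw [Finset.mem_range] at hk; omega)
    rw [Finset.sum_add_distrib, Finset.sum_const, Finset.card_range, smul_eq_mul] at this
    rwa [add_comm]
  have hlastsum : ∀ c : Fin N, (c : ℕ) + 1 = N → ∑ k ∈ Finset.range (t + 1), τ c k +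
      (t + 1) * ∑ x, zq x ≤ ∑ k ∈ Finset.range (t + 1), k + (t + 1) * t := by
    intro c hc
    have := Finset.sum_le_sum fun k (hk : k ∈ Finset.range (t + 1)) =>
      hlast c hc k (by rw [Finset.mem_range] at hk; omega)
    simpa only [Finset.sum_add_distrib, Finset.sum_const, Finset.card_range, smul_eq_mul] using this
  have hmul := congrArg (t * ·) htotal
  simp only [mul_add, mul_one] at hmul
  -- The prescribed growth is t per base point plus the excess, and a base point at the first `p` or
  -- the last `q` shifts all t + 1 indices. Comparing the two ends leaves no room for free-end base
  -- points or excess.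
  have tight := chain_tight (S := fun c => ∑ k ∈ Finset.range (t + 1), σ c k)
    (T := fun c => ∑ k ∈ Finset.range (t + 1), τ c k)
    (L := fun c => ∑ k ∈ Finset.range (t + 1), k + (t + 1) * ∑ x, zp x + sumBefore κ c)
    (R := fun c => ∑ k ∈ Finset.range (t + 1), k + (t + 1) * ∑ x, zp x + (sumBefore κ c + κ c))
    (fun c => by
      have := (hgrow c).1
      simp only [hκ]
      omega)
    (fun c c' hcc' => Finset.sum_le_sum fun k hk =>
      hnext c c' hcc' k (by rw [Finset.mem_range] at hk; omega))
    (fun c c' hcc' => by simp only [sumBefore_succ _ hcc'])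
    (fun c hc => by
      rw [sumBefore_zero _ hc]
      exact hfirstsum c hc)
    (fun c hc => by
      have := hlastsum c hc
      rw [sumBefore_last _ hc, hκsum]
      simp only [add_mul, one_mul] at this ⊢
      omega)
  have hN : 0 < N := by
    rcases Nat.eq_zero_or_pos N with rfl | h
    · simp at htotal
    · exact h
  have hzero : ∑ x, zp x = 0 ∧ ∑ x, zq x = 0 ∧ ∑ x, X.excess d x = 0 := by
    have hc : ((⟨N - 1, by omega⟩ : Fin N) : ℕ) + 1 = N := by
      simp only
      omega
    have h1 := hlastsum _ hc
    have h2 := (tight ⟨N - 1, by omega⟩).2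
    rw [sumBefore_last _ hc, hκsum] at h2
    simp only [add_mul, one_mul] at h1 h2
    omega
  have hzp' : ∀ c, zp c = 0 := fun c => Finset.sum_eq_zero_iff.1 hzero.1 c (Finset.mem_univ c)
  have hzq' : ∀ c, zq c = 0 := fun c => Finset.sum_eq_zero_iff.1 hzero.2.1 c (Finset.mem_univ c)
  have hex : ∀ c, X.excess d c = 0 :=
    fun c => Finset.sum_eq_zero_iff.1 hzero.2.2 c (Finset.mem_univ c)
  have hκ' : ∀ c, sumBefore κ c = t * sumBefore d c := by
    intro c
    unfold sumBefore
    rw [Finset.mul_sum]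
    exact Finset.sum_congr rfl fun x _ => by simp only [hκ, hex, add_zero]
  have hκ'' : ∀ c, κ c = t * d c := fun c => by simp only [hκ, hex, add_zero]
  simp only [hκ', hκ'', hzero.1, mul_zero, add_zero, ← mul_add] at tight
  have hle1 : ∀ c, d c ≤ 1 := by
    intro c
    have := hex c
    unfold excess at this
    split_ifs at this <;> omega
  have hell : ∀ c, d c = 1 → c ∈ Set.range X.elliptic := by
    intro c hc
    have := hex c
    unfold excess at this
    by_contra hcon
    rw [if_neg hcon, if_pos (by omega)] at this
    omega
  refine ⟨d, σ, τ, fun c => by rw [hdeg, hzp', hzq', add_zero, add_zero],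
    fun c => by rw [hzp, hzp', Nat.cast_zero], fun c => by rw [hzq, hzq', Nat.cast_zero], hle1,
    hell, hσ, hτ, fun c k hk => ⟨(hστ c k hk).1, ?_⟩, fun c k hk => (hστ c k hk).2.1,
    fun c k hk => (hστ c k hk).2.2.1, fun c k hk => (hστ c k hk).2.2.2, fun c => (tight c).1,
    fun c => (tight c).2, hnext, fun c hc k hk => ?_, fun c hc k hk => ?_⟩
  · have hs := tight c
    have hcases : d c = 0 ∨ d c = 1 := by
      have := hle1 c
      omega
    rcases hcases with h0 | h1
    · rw [h0, add_zero] at hs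
      have := index_le_of_sum_eq_zero (fun k hk => (hστ c k hk).1) (hs.2.trans hs.1.symm) k hk
      omega
    · rw [h1]
      refine (hgrow c).2 (hell c h1) h1 ?_ k hk
      rw [hs.1, hs.2, h1, mul_add, mul_one, add_assoc]
  · have := hfirst c hc k hk
    omega
  · have := hlast c hc k hk
    omega

/-- A single index gains at most one per base point and covers only t steps with t + 1 base points,
so it always equals k plus the number of base points passed, or one less. The known sums then
determine all indices. -/
theorem Inclusion.HasIndices.eq_shiftIndex {I : X.Inclusion t (t + 1) (2 * t * (u' + 1)) D V}
    {d : Fin N → ℕ} {σ τ : Fin N → ℕ → ℕ} (h : I.HasIndices d σ τ) (c : Fin N) :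
    ∀ k ≤ t, σ c k = shiftIndex (sumBefore d c) k ∧
      τ c k = shiftIndex (sumBefore d c + d c) k := by
  have hbounds : ∀ c, ∀ k ≤ t, σ c k ≤ k + sumBefore d c ∧ τ c k ≤ k + (sumBefore d c + d c) ∧
      k + sumBefore d c ≤ σ c k + 1 ∧ k + (sumBefore d c + d c) ≤ τ c k + 1 := by
    intro c k hk
    refine chain_bounds (S := fun c => σ c k) (T := fun c => τ c k)
      (L := fun c => k + sumBefore d c) (R := fun c => k + (sumBefore d c + d c))
      (fun c => ?_) (fun c c' hcc' => ?_) (fun c c' hcc' => ?_) (fun c hc => ?_) (fun c hc => ?_) c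
    · have := h.le c k hk
      omega
    -- The sums on both sides of a node coincide, so the termwise inequalities there are equalities.
    · refine index_le_of_sum_eq_zero (h.next c c' hcc') ?_ k hk
      rw [h.sum_left, h.sum_right, sumBefore_succ d hcc']
    · simp only [sumBefore_succ d hcc']
    · refine le_of_eq ?_
      simp only [sumBefore_zero d hc]
      refine index_le_of_sum_eq_zero (h.first c hc) ?_ k hk
      rw [h.sum_left, sumBefore_zero d hc, mul_zero, add_zero]
    · have hk' : k + t = τ c k := by
        refine index_le_of_sum_eq_zero (τ := fun k => k + t) (h.last c hc) ?_ k hk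
        rw [h.sum_right, sumBefore_last d hc, I.sum_deg h.deg_eq, Finset.sum_add_distrib,
          Finset.sum_const, Finset.card_range, smul_eq_mul, mul_comm]
      rw [sumBefore_last d hc, I.sum_deg h.deg_eq]
      omega
  intro k hk
  exact ⟨_root_.eq_shiftIndex (h.mono_left c) (fun k hk => (hbounds c k hk).1)
      (fun k hk => (hbounds c k hk).2.2.1) (h.sum_left c) k hk,
    _root_.eq_shiftIndex (h.mono_right c) (fun k hk => (hbounds c k hk).2.1)
      (fun k hk => (hbounds c k hk).2.2.2) (h.sum_right c) k hk⟩

/-- A distribution of `t + 1` base points on the components for which there is an inclusion. -/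
structure IsBaseDistribution (X : EllipticChain.{u, v} K ((2 * t + 1) * u') N) (d : Fin N → ℕ) :
    Prop where
  sum_eq : ∑ c, d c = t + 1
  le_one : ∀ c, d c ≤ 1
  exists_elliptic : ∀ c, d c = 1 → ∃ j, X.elliptic j = c ∧
    2 * sumBefore d c ≠ (j : ℕ) % (2 * t + 1)

/-- The data on the component `c` of an inclusion with base points distributed as `d`. -/
def IsComponentInclusion (X : EllipticChain.{u, v} K ((2 * t + 1) * u') N)
    (D : ∀ c, CurveDivisor K (X.F c)) (V : ∀ c, Submodule K (X.F c)) (d : Fin N → ℕ) (c : Fin N)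
    (BW : CurveDivisor K (X.F c) × Submodule K (X.F c)) : Prop :=
  BW.1.deg = d c ∧ IsLocalInclusion (D c) (V c) (X.p c) (X.q c) t (2 * t * (u' + 1))
    (orderAt t (X.numBefore c)) (orderAt t (X.numBefore c + indicatorRange X.elliptic c))
    (shiftIndex (sumBefore d c)) (shiftIndex (sumBefore d c + d c)) BW.1 BW.2

theorem Inclusion.exists_isBaseDistribution [IsAlgClosed K]
    (hV : X.IsLimitLinearSeries (2 * t) (2 * t * (u' + 1)) D V)
    (hw : X.HasWordType (2 * t) (2 * t * (u' + 1)) D V (periodicWord t u'))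
    (I : X.Inclusion t (t + 1) (2 * t * (u' + 1)) D V) :
    ∃ d, X.IsBaseDistribution d ∧ ∀ c, X.IsComponentInclusion D V d c (I.base c, I.W c) := by
  obtain ⟨d, σ, τ, h⟩ := I.exists_hasIndices hV hw
  have hσ := h.eq_shiftIndex
  have hW := fun c => I.isLimitLinearSeries.isLinearSeries c
  have hsum := I.sum_deg h.deg_eq
  refine ⟨d, ⟨hsum, h.le_one, fun c hc => ?_⟩, fun c => ⟨h.deg_eq c, ?_⟩⟩
  · obtain ⟨j, rfl⟩ := h.elliptic c hc
    refine ⟨j, rfl, fun hj => ?_⟩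
    obtain ⟨f, hf⟩ := exists_adaptedFrame hV hw (X.elliptic j)
    have he : sumBefore d (X.elliptic j) ≤ t := by
      have := sumBefore_add_le d (X.elliptic j)
      omega
    -- Index e stalls at the value 2e although one base point is present, so the ambient order of
    -- index 2e must increase. It would not if 2e were the letter of this component.
    have h1 := hf.index_add_deg_le (hasTrivialResidues (X.isCurve _)) (X.degNonneg _) (hW _)
      (I.vanish_on_base _) (h.base_p _) (h.base_q _) he (h.seq_p _ _ he) (h.seq_q _ _ he)
    rw [h.deg_eq, hc, (hσ _ _ he).1, (hσ _ _ he).2, hc, shiftIndex_succ_self, shiftIndex_self,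
      indicatorRange_apply, orderAt_succ t _ (by omega), numBefore, sumBefore_indicatorRange,
      if_pos hj] at h1
    omega
  · refine ⟨I.base_effective c, h.base_p c, h.base_q c, I.le_ambient c, I.vanish_on_base c, hW c,
      fun k hk => ?_, fun k hk => ?_⟩
    · rw [h.seq_p c k hk, (hσ c k hk).1]
    · rw [h.seq_q c k hk, (hσ c k hk).2]

/-- Without a base point the adapted basis spans the subseries. With one, the condition in
`IsBaseDistribution` says that the ambient order at the stalled index increases, as the local
existence result requires. -/
theorem existsUnique_isComponentInclusion [IsAlgClosed K]
    (hV : X.IsLimitLinearSeries (2 * t) (2 * t * (u' + 1)) D V)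
    (hw : X.HasWordType (2 * t) (2 * t * (u' + 1)) D V (periodicWord t u'))
    {d : Fin N → ℕ} (hd : X.IsBaseDistribution d) (c : Fin N) :
    ∃! BW, X.IsComponentInclusion D V d c BW := by
  have hres := hasTrivialResidues (X.isCurve c)
  obtain ⟨f, hf⟩ := exists_adaptedFrame hV hw c
  have hsum := sumBefore_add_le d c
  rw [hd.sum_eq] at hsum
  have hcases : d c = 0 ∨ d c = 1 := by
    have := hd.le_one c
    omega
  unfold IsComponentInclusion
  rcases hcases with h0 | h1
  · rw [h0, add_zero]
    obtain ⟨W, hW, huniq⟩ := hf.existsUnique_isLocalInclusion_zero hres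
      ((shiftIndex_strictMono (sumBefore d c)).strictMonoOn (Set.Iic t))
      fun k hk => shiftIndex_le (by omega) hk
    refine ⟨(0, W), ⟨deg_zero, hW⟩, ?_⟩
    rintro ⟨B, W'⟩ ⟨hB, hW'⟩
    obtain rfl := eq_zero_of_deg_eq_zero hW'.effective hB
    rw [huniq W' hW']
  · obtain ⟨j, rfl, hj⟩ := hd.exists_elliptic c h1
    rw [indicatorRange_apply] at hf
    rw [h1, indicatorRange_apply]
    refine hf.existsUnique_isLocalInclusion_one hres (X.degNonneg _) (X.nontorsion j)
      (fun i hi => ?_) ((shiftIndex_strictMono _).strictMonoOn _)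
      ((shiftIndex_strictMono _).strictMonoOn _) (fun k hk => shiftIndex_le (by omega) hk)
      (e := sumBefore d (X.elliptic j)) (by omega) (shiftIndex_succ_self _)
      (fun k _ hk => shiftIndex_succ_of_ne hk) ?_
    · rw [orderAt_succ t _ hi]
      split_ifs <;> omega
    · rw [shiftIndex_self, orderAt_succ t _ (by omega), numBefore, sumBefore_indicatorRange,
        if_neg hj]

theorem Inclusion.eq_of_deg_eq [IsAlgClosed K]
    (hV : X.IsLimitLinearSeries (2 * t) (2 * t * (u' + 1)) D V)
    (hw : X.HasWordType (2 * t) (2 * t * (u' + 1)) D V (periodicWord t u'))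
    {I I' : X.Inclusion t (t + 1) (2 * t * (u' + 1)) D V}
    (h : ∀ c, (I.base c).deg = (I'.base c).deg) : I = I' := by
  obtain ⟨d, hd, hI⟩ := I.exists_isBaseDistribution hV hw
  obtain ⟨d', hd', hI'⟩ := I'.exists_isBaseDistribution hV hw
  obtain rfl : d = d' := by
    funext c
    have h1 := (hI c).1
    have h2 := (hI' c).1
    have h3 := h c
    simp only at h1 h2
    omega
  have heq := fun c => (existsUnique_isComponentInclusion hV hw hd c).unique (hI c) (hI' c)
  refine Inclusion.ext ?_ ?_
  · funext c
    exact congrArg Prod.fst (heq c)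
  · funext c
    exact congrArg Prod.snd (heq c)

theorem IsBaseDistribution.exists_inclusion [IsAlgClosed K]
    (hV : X.IsLimitLinearSeries (2 * t) (2 * t * (u' + 1)) D V)
    (hw : X.HasWordType (2 * t) (2 * t * (u' + 1)) D V (periodicWord t u'))
    {d : Fin N → ℕ} (hd : X.IsBaseDistribution d) :
    ∃ I : X.Inclusion t (t + 1) (2 * t * (u' + 1)) D V, ∀ c, (I.base c).deg = d c := by
  choose BW hBW using fun c => (existsUnique_isComponentInclusion hV hw hd c).exists
  have hloc := fun c => (hBW c).2
  refine ⟨⟨fun c => (BW c).1, fun c => (BW c).2, fun c => (hloc c).effective, ?_,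
    fun c _ => (hloc c).base_p, fun c _ => (hloc c).base_q,
    ⟨hV.degree, fun c => (hloc c).series.le_sections, fun c => (hloc c).series.finrank_eq, ?_⟩,
    fun c => (hloc c).le_ambient, fun c => (hloc c).vanish_on_base⟩, fun c => (hBW c).1⟩
  · rw [Finset.sum_congr rfl fun c _ => (hBW c).1]
    exact_mod_cast hd.sum_eq
  -- The right indices on a component are the left indices on the next, so the compatibility
  -- inequality holds with equality.
  · intro c c' hcc' i hi
    have h1 := (hloc c).seq_q (t - i) (by omega)
    have h2 := (hloc c').seq_p (t - i) (by omega)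
    have h3 : X.numBefore c' = X.numBefore c + indicatorRange X.elliptic c :=
      sumBefore_succ _ hcc'
    rw [show t - (t - i) = i by omega] at h1
    rw [h3, sumBefore_succ d hcc'] at h2
    omega

/-! ### Distributions of base points as admissible tuples. -/

/-- The components containing the points of a tuple. -/
def componentEmbedding (X : EllipticChain.{u, v} K ((2 * t + 1) * u') N) {j : Fin (t + 1) → ℕ}
    (hj : j ∈ admissibleTuples t u') : Fin (t + 1) ↪o Fin N :=
  OrderEmbedding.ofStrictMono
    (fun k => X.elliptic ⟨j k - 1, by have := hj.2.1 k; omega⟩) fun k l hkl => by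
      refine X.elliptic.strictMono ?_
      have h1 := hj.1 hkl
      have h2 := hj.2.1 k
      simp only [Fin.mk_lt_mk]
      omega

theorem componentEmbedding_eq_iff {j : Fin (t + 1) → ℕ} (hj : j ∈ admissibleTuples t u')
    (k : Fin (t + 1)) (i : Fin ((2 * t + 1) * u')) :
    X.componentEmbedding hj k = X.elliptic i ↔ j k = i + 1 := by
  have h2 := hj.2.1 k
  change X.elliptic _ = _ ↔ _
  rw [X.elliptic.injective.eq_iff, Fin.ext_iff]
  simp only
  omega

theorem ncard_eq_indicatorRange {j : Fin (t + 1) → ℕ} (hj : j ∈ admissibleTuples t u')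
    (c : Fin N) : {k : Fin (t + 1) | ∃ i : Fin ((2 * t + 1) * u'),
      X.elliptic i = c ∧ j k = (i : ℕ) + 1}.ncard = indicatorRange (X.componentEmbedding hj) c := by
  have hset : {k : Fin (t + 1) | ∃ i : Fin ((2 * t + 1) * u'),
      X.elliptic i = c ∧ j k = (i : ℕ) + 1} = {k | X.componentEmbedding hj k = c} := by
    ext k
    constructor
    · rintro ⟨i, rfl, hi⟩
      exact (componentEmbedding_eq_iff hj k i).2 hi
    · intro hk
      have hk' : X.componentEmbedding hj k = c := hk
      exact ⟨⟨j k - 1, by have := hj.2.1 k; omega⟩, hk',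
        (componentEmbedding_eq_iff (X := X) hj k _).1 rfl⟩
  rw [hset]
  by_cases hc : c ∈ Set.range (X.componentEmbedding hj)
  · obtain ⟨k, rfl⟩ := hc
    rw [indicatorRange_apply, Set.ncard_eq_one]
    refine ⟨k, ?_⟩
    ext l
    exact (X.componentEmbedding hj).injective.eq_iff
  · rw [indicatorRange_of_notMem hc, Set.ncard_eq_zero]
    exact Set.eq_empty_of_forall_notMem fun k hk => hc ⟨k, hk⟩

/-- This translates the congruence for one-based positions into the letter of the zero-based
component. -/
theorem modEq_iff_pred_mod_eq {n x y : ℕ} (hx : 1 ≤ x) (hy : y < n) :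
    x ≡ y + 1 [MOD n] ↔ y = (x - 1) % n := by
  obtain ⟨x, rfl⟩ := Nat.exists_eq_add_of_le' hx
  rw [Nat.add_sub_cancel]
  constructor
  · intro h
    have h' : x % n = y % n := Nat.ModEq.add_right_cancel' 1 h
    rw [h', Nat.mod_eq_of_lt hy]
  · intro h
    refine Nat.ModEq.add_right 1 ?_
    rw [Nat.ModEq, ← h, Nat.mod_eq_of_lt hy]

theorem isBaseDistribution_indicatorRange {j : Fin (t + 1) → ℕ} (hj : j ∈ admissibleTuples t u') :
    X.IsBaseDistribution (indicatorRange (X.componentEmbedding hj)) := by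
  refine ⟨sum_indicatorRange _, fun c => ?_, fun c hc => ?_⟩
  · unfold indicatorRange
    split_ifs <;> omega
  · have hc' : c ∈ Set.range (X.componentEmbedding hj) := by
      by_contra hcon
      rw [indicatorRange_of_notMem hcon] at hc
      omega
    obtain ⟨k, rfl⟩ := hc'
    refine ⟨⟨j k - 1, by have := hj.2.1 k; omega⟩, rfl, fun h => ?_⟩
    rw [sumBefore_indicatorRange] at h
    exact hj.2.2 k ((modEq_iff_pred_mod_eq (hj.2.1 k).1
      (show 2 * (k : ℕ) < 2 * t + 1 by omega)).2 h)

/-- The tuple lists the components carrying a base point in increasing order. Exactly k base points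
precede the entry with zero-based index k, so the condition on `2 * sumBefore d c` is the congruence
condition for that entry. -/
theorem IsBaseDistribution.exists_tuple {d : Fin N → ℕ} (hd : X.IsBaseDistribution d) :
    ∃ (j : Fin (t + 1) → ℕ) (hj : j ∈ admissibleTuples t u'),
      d = indicatorRange (X.componentEmbedding hj) := by
  classical
  set S : Finset (Fin N) := Finset.univ.filter fun c => d c = 1 with hS
  have hd01 : ∀ c, d c = if d c = 1 then 1 else 0 := by
    intro c
    have := hd.le_one c
    split_ifs <;> omega
  have hcard : S.card = t + 1 := by
    rw [hS, Finset.card_filter, ← hd.sum_eq]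
    exact Finset.sum_congr rfl fun c _ => (hd01 c).symm
  set φ := S.orderEmbOfFin hcard with hφ
  have hrange : Set.range φ = {c | d c = 1} := by
    rw [hφ, Finset.range_orderEmbOfFin]
    ext c
    simp [hS]
  have hφd : d = indicatorRange φ := by
    funext c
    by_cases hc : d c = 1
    · have : c ∈ Set.range φ := hrange ▸ hc
      obtain ⟨k, rfl⟩ := this
      rw [indicatorRange_apply, hc]
    · rw [indicatorRange_of_notMem (by rw [hrange]; exact hc), hd01 c, if_neg hc]
  choose i hi hmod using fun k : Fin (t + 1) => hd.exists_elliptic (φ k)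
    (show φ k ∈ {c | d c = 1} from hrange ▸ Set.mem_range_self k)
  have hj : (fun k => (i k : ℕ) + 1) ∈ admissibleTuples t u' := by
    refine ⟨fun k l hkl => ?_, fun k => ⟨Nat.le_add_left 1 _, ?_⟩, fun k h => ?_⟩
    · have : X.elliptic (i k) < X.elliptic (i l) := by
        rw [hi, hi]
        exact φ.strictMono hkl
      have h2 := X.elliptic.lt_iff_lt.1 this
      rw [Fin.lt_def] at h2
      simp only
      omega
    · have := (i k).2
      simp only
      omega
    · refine hmod k ?_
      rw [modEq_iff_pred_mod_eq (Nat.le_add_left 1 _) (show 2 * (k : ℕ) < 2 * t + 1 by omega),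
        Nat.add_sub_cancel] at h
      rw [← h, hφd, sumBefore_indicatorRange]
  refine ⟨_, hj, ?_⟩
  rw [hφd]
  congr 1
  ext k
  rw [(componentEmbedding_eq_iff (X := X) hj k (i k)).2 rfl, hi]

theorem eq_of_indicatorRange_eq {j j' : Fin (t + 1) → ℕ} (hj : j ∈ admissibleTuples t u')
    (hj' : j' ∈ admissibleTuples t u')
    (h : indicatorRange (X.componentEmbedding hj) = indicatorRange (X.componentEmbedding hj')) :
    j = j' := by
  have hle : ∀ {j j' : Fin (t + 1) → ℕ} (hj : j ∈ admissibleTuples t u')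
      (hj' : j' ∈ admissibleTuples t u'), indicatorRange (X.componentEmbedding hj) =
        indicatorRange (X.componentEmbedding hj') →
      Set.range (X.componentEmbedding hj) ⊆ Set.range (X.componentEmbedding hj') := by
    rintro j j' hj hj' h _ ⟨k, rfl⟩
    by_contra hcon
    have h1 := indicatorRange_apply (X.componentEmbedding hj) k
    rw [h, indicatorRange_of_notMem hcon] at h1
    omega
  have heq := ((X.componentEmbedding hj).strictMono.range_inj
    (X.componentEmbedding hj').strictMono).1
    (Set.Subset.antisymm (hle hj hj' h) (hle hj' hj h.symm))
  funext k
  have h1 := congrFun heq k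
  have h2 := (componentEmbedding_eq_iff (X := X) hj k ⟨j' k - 1, by have := hj'.2.1 k; omega⟩).1 h1
  have := (hj'.2.1 k).1
  simp only at h2
  omega

end EllipticChain

theorem mainTheorem8 {K : Type u} [Field K] [IsAlgClosed K]
    (t u N : ℕ) (ht : 0 < t) (hu : 0 < u)
    (X : EllipticChain.{u, v} K ((2 * t + 1) * u) N)
    (D : ∀ c, CurveDivisor K (X.F c)) (V : ∀ c, Submodule K (X.F c))
    (hV : X.IsLimitLinearSeries (2 * t) (2 * t * (u + 1)) D V)
    (hw : X.HasWordType (2 * t) (2 * t * (u + 1)) D V (periodicWord t u)) :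
    ∃ Φ : X.Inclusion t (t + 1) (2 * t * (u + 1)) D V ≃ admissibleTuples t u,
      ∀ (I : X.Inclusion t (t + 1) (2 * t * (u + 1)) D V) (c : Fin N),
        (I.base c).deg =
          {k : Fin (t + 1) | ∃ j : Fin ((2 * t + 1) * u),
            X.elliptic j = c ∧ (Φ I).1 k = (j : ℕ) + 1}.ncard := by
  have hex : ∀ I : X.Inclusion t (t + 1) (2 * t * (u + 1)) D V, ∃ j : admissibleTuples t u,
      ∀ c, (I.base c).deg = indicatorRange (X.componentEmbedding j.2) c := by
    intro I
    obtain ⟨d, hd, hI⟩ := I.exists_isBaseDistribution hV hw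
    obtain ⟨j, hj, rfl⟩ := hd.exists_tuple
    exact ⟨⟨j, hj⟩, fun c => (hI c).1⟩
  choose φ hφ using hex
  have hbij : Function.Bijective φ := by
    constructor
    · intro I I' h
      refine EllipticChain.Inclusion.eq_of_deg_eq hV hw fun c => ?_
      rw [hφ, hφ, h]
    · intro j
      obtain ⟨I, hI⟩ := (EllipticChain.isBaseDistribution_indicatorRange (X := X) j.2).exists_inclusion hV hw
      refine ⟨I, Subtype.ext (EllipticChain.eq_of_indicatorRange_eq (X := X) (φ I).2 j.2 ?_)⟩
      funext c
      have h1 := hφ I c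
      rw [hI c] at h1
      exact_mod_cast h1.symm
  refine ⟨Equiv.ofBijective φ hbij, fun I c => ?_⟩
  rw [Equiv.ofBijective_apply, EllipticChain.ncard_eq_indicatorRange (φ I).2]
  exact hφ I c
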